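/- Let $q$ be a prime power, let $1\le \ell<m$ be integers, and let $V$ be an $m$-dimensional vector space over $\mathbb{F}_q$. Fix a basis of $V$ and use it to identify $\bigwedge^m V$ with $\mathbb{F}_q$. Let $A_1\subsetneq\cdots\subsetneq A_\ell$ be nonzero subspaces of $V$, put $\alpha_i=\dim A_i$, $\alpha=(\alpha_1,\dots,\alpha_\ell)$ and $\delta(\alpha)=\sum_{i=1}^{\ell}(\alpha_i-i)$. Let $$\Omega_\alpha(\ell,m)=\{L\subseteq V : \dim L=\ell,\ \dim(L\cap A_i)\ge i \text{ for } i=1,\dots,\ell\}.$$ For $f\in\bigwedge^d V$ write $V_f=\{x\in V: f\wedge x=0\}$. Enumerate $\Omega_\alpha(\ell,m)=\{L_1,\dots,L_n\}$ without repetition and choose representatives $P_1,\dots,P_n\in\bigwedge^{\ell}V$ such that each $P_j$ has the form $v_\ell\wedge\cdots\wedge v_1$ with $v_i\in A_i$ for all $i$, and $V_{P_j}=L_j$. For $f\in\bigwedge^{m-\ell}V$ put $c_f=(f\wedge P_1,\dots,f\wedge P_n)\in\mathbb{F}_q^n$. The Schubert code is $C_\alpha(\ell,m)=\{c_f: f\in\bigwedge^{m-\ell}V\}$.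 A codeword is of minimum weight if its Hamming weight $\operatorname{wt}$ equals the minimum of the Hamming weights of the nonzero codewords. Call $f\in\bigwedge^{m-\ell}V$ Schubert decomposable (with respect to $\Omega_\alpha(\ell,m)$) if $f\neq0$, $f=f_1\wedge\cdots\wedge f_{m-\ell}$ for some $f_1,\dots,f_{m-\ell}\in V$, and $\dim(V_f\cap A_p)=\alpha_p-p$ for every $p\in\{1,\dots,\ell\}$ such that $p=\ell$ or $\alpha_{p+1}-\alpha_p\ge2$. **Theorem.** If $f\in\bigwedge^{m-\ell}V$ is Schubert decomposable, then $c_f$ is a minimum weight codeword of $C_\alpha(\ell,m)$, and moreover $\operatorname{wt}(c_f)=q^{\delta(\alpha)}$. -/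

import Mathlib

open Module

namespace SchubertCode

noncomputable section

variable {F V : Type*} [Field F] [AddCommGroup V] [Module F V]

/-- The wedge product `⋀^a V → ⋀^c V → ⋀^m V` for `a + c = m`: the product of the exterior
algebra, restricted to homogeneous elements. -/
def wedge {a c m : ℕ} (h : a + c = m) (f : ⋀[F]^a V) (g : ⋀[F]^c V) : ⋀[F]^m V :=
  ⟨(f : ExteriorAlgebra F V) * (g : ExteriorAlgebra F V), by
    subst h
    change _ ∈ LinearMap.range (ExteriorAlgebra.ι F) ^ (a + c)
    rw [pow_add]
    exact Submodule.mul_mem_mul f.2 g.2⟩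

/-- `f ∈ ⋀^d V` is decomposable: `f ≠ 0` and `f = f₁ ∧ ⋯ ∧ f_d` for some vectors `fᵢ`. -/
def Decomposable {d : ℕ} (f : ⋀[F]^d V) : Prop :=
  f ≠ 0 ∧ ∃ v : Fin d → V, f = exteriorPower.ιMulti F d v

/-- The annihilator `V_f = {x ∈ V : f ∧ x = 0}` of `f ∈ ⋀^d V`. -/
def annihilator {d : ℕ} (f : ⋀[F]^d V) : Submodule F V :=
  LinearMap.ker
    (LinearMap.mulLeft F (f : ExteriorAlgebra F V) ∘ₗ ExteriorAlgebra.ι F)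

/-- The identification `⋀^m V = F` given by a basis `b = (b₁, …, b_m)` of `V`; it sends
`v₁ ∧ ⋯ ∧ v_m` to the determinant of `(v₁, …, v_m)` in the basis `b`, so `b₁ ∧ ⋯ ∧ b_m ↦ 1`. -/
def topCoord {m : ℕ} (b : Basis (Fin m) F V) : ⋀[F]^m V →ₗ[F] F :=
  exteriorPower.alternatingMapLinearEquiv b.det

/-- The Schubert variety of the flag `A₁ ⊂ ⋯ ⊂ A_ℓ`: all `ℓ`-dimensional subspaces `L` of `V`
with `dim (L ∩ Aᵢ) ≥ i` for `i = 1, …, ℓ`. The index `i : Fin ℓ` stands for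
the one-based index `i + 1`. -/
def schubertVariety {ℓ : ℕ} (A : Fin ℓ → Submodule F V) : Set (Submodule F V) :=
  {L | finrank F L = ℓ ∧ ∀ i : Fin ℓ, (i : ℕ) + 1 ≤ finrank F ↥(L ⊓ A i)}

/-- The position `i` (that is, `p = i + 1` counted from one) ends one of the maximal blocks of
consecutive integers into which the dimension sequence `αᵢ = dim Aᵢ` splits: either it is the
last position, `p = ℓ`, or `α_{p+1} - α_p ≥ 2`. These are the
positions `p₁ < ⋯ < p_u < p_{u+1} = ℓ`. -/
def IsBlockEnd {ℓ : ℕ} (A : Fin ℓ → Submodule F V) (i : Fin ℓ) : Prop :=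
  ∀ h : (i : ℕ) + 1 < ℓ, finrank F (A i) + 2 ≤ finrank F (A ⟨i + 1, h⟩)

/-- `f` is Schubert decomposable with respect to the flag `A`: it is decomposable, and
`dim (V_f ∩ A_p) = α_p - p` whenever `p` is the end of a block (written without subtraction). -/
def SchubertDecomposable {ℓ d : ℕ} (A : Fin ℓ → Submodule F V) (f : ⋀[F]^d V) : Prop :=
  Decomposable f ∧ ∀ i : Fin ℓ, IsBlockEnd A i →
    finrank F ↥(annihilator f ⊓ A i) + ((i : ℕ) + 1) = finrank F (A i)

/-- `P` is an admissible representative of the point `L` of the Schubert variety: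
`P = v_ℓ ∧ ⋯ ∧ v₁` with `vᵢ ∈ Aᵢ` for all `i`, and `L = V_P`. -/
def IsRepresentative {ℓ : ℕ} (A : Fin ℓ → Submodule F V) (L : Submodule F V)
    (P : ⋀[F]^ℓ V) : Prop :=
  ∃ v : Fin ℓ → V, (∀ i, v i ∈ A i) ∧
    P = exteriorPower.ιMulti F ℓ (fun i => v i.rev) ∧ annihilator P = L

/-- The evaluation map `f ↦ c_f = (f ∧ P₁, …, f ∧ P_n)` from `⋀^(m-ℓ) V` to `F^n`. -/
def evalMap {ℓ m n : ℕ} (hℓm : ℓ < m) (b : Basis (Fin m) F V) (P : Fin n → ⋀[F]^ℓ V) :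
    ⋀[F]^(m - ℓ) V →ₗ[F] (Fin n → F) where
  toFun f j := topCoord b (wedge (Nat.sub_add_cancel hℓm.le) f (P j))
  map_add' f g := by
    funext j
    rw [Pi.add_apply, ← map_add]
    congr 1
    exact Subtype.ext (add_mul _ _ _)
  map_smul' r f := by
    funext j
    rw [Pi.smul_apply, RingHom.id_apply, ← map_smul]
    congr 1
    exact Subtype.ext (smul_mul_assoc _ _ _)

/-- The Schubert code: the image of the evaluation map. -/
def schubertCode {ℓ m n : ℕ} (hℓm : ℓ < m) (b : Basis (Fin m) F V) (P : Fin n → ⋀[F]^ℓ V) :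
    Submodule F (Fin n → F) :=
  LinearMap.range (evalMap hℓm b P)

/-- `c` is a minimum weight codeword of the linear code `C`: `c ∈ C` and the Hamming weight of
`c` is the minimum distance `min {wt(c') : c' ∈ C, c' ≠ 0}`. -/
def IsMinWeightCodeword [DecidableEq F] {n : ℕ} (C : Submodule F (Fin n → F))
    (c : Fin n → F) : Prop :=
  c ∈ C ∧ IsLeast {w : ℕ | ∃ c' ∈ C, c' ≠ 0 ∧ hammingNorm c' = w} (hammingNorm c)

/-- `δ(α) = ∑ᵢ (αᵢ - i)` for the dimension sequence `αᵢ = dim Aᵢ` of a strictly increasing flag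
of nonzero subspaces (so `αᵢ ≥ i` and no subtraction is truncated). -/
def delta {ℓ : ℕ} (A : Fin ℓ → Submodule F V) : ℕ :=
  ∑ i : Fin ℓ, (finrank F (A i) - ((i : ℕ) + 1))

end

end SchubertCode

/-! Wedging with `f` gives an alternating form `φ` of degree `ℓ` on `V`. A coordinate of `c_f` is
nonzero exactly when `φ` does not vanish on the corresponding `L`, so the weight of `c_f` is the
size of `support A φ` (`hammingNorm_evalMap`).

Exact weight. For decomposable `f`, `φ` is nonzero on `L` iff `L` meets `W = V_f` trivially
(`nonzeroOn_wedgeForm_iff`). If `p` is the end of the block of position `i`, such `L` in the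
Schubert variety have the same image modulo `W` as `A_p` when cut with `A_p`. Fixing independent
vectors `u_i` in these images, `L` corresponds to a choice of lifts of the `u_i`, each lift ranging
over a coset of `W ∩ A_p`. This set has `q^(α_p - p) = q^(α_i - i)` elements, and the product over
`i` is `q^δ` (`ncard_complements`).

Lower bound (`pow_delta_le_ncard_support`), for every form with nonempty support, by induction on
`ℓ` and then on `α_ℓ`. Put `B = A_{ℓ-1}` and let `K` be `lastKernel`. For `x` in `A_ℓ` outside `B ∪
K`, the contraction of `φ` by `x` has nonempty support for the truncated flag; counting pairs `(x,
L')` bounds the points not inside `B` from below by a multiple of `|A_ℓ \ (B ∪ K)|`. This suffices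
when `|B ∪ K| ≤ q^(α_ℓ - 1)`, which can fail only if `B` is a hyperplane of `A_ℓ` and `K ⊄ B`. The
deficit is then made up by points inside `B`: they contain the support of `φ` for a flag ending in
`B`, got by lowering the last block, and `K` is small enough for the two counts to add up to `q^δ`
(`pow_delta_le_of_hyperplane`). -/

namespace SchubertCode

/-! ### Linear algebra: adapted bases of points and supports of alternating forms. -/

section LinearAlgebra

variable {F V : Type*} [Field F] [AddCommGroup V] [Module F V]

theorem natCard_submodule [Finite F] [FiniteDimensional F V] (W : Submodule F V) :
    Nat.card W = Nat.card F ^ finrank F W :=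
  Module.natCard_eq_pow_finrank

theorem ncard_coe_submodule [Finite F] [FiniteDimensional F V] (W : Submodule F V) :
    (W : Set V).ncard = Nat.card F ^ finrank F W :=
  natCard_submodule W

instance finite_submodule [Finite V] : Finite (Submodule F V) :=
  Finite.of_injective (fun W => (W : Set V)) SetLike.coe_injective

/-- Vectors can be chosen greedily: if `dim Cᵢ > i` then there are linearly independent
`uᵢ ∈ Cᵢ`. -/
theorem exists_linearIndependent_mem [FiniteDimensional F V] {n : ℕ}
    (C : Fin n → Submodule F V) (hC : ∀ i : Fin n, (i : ℕ) + 1 ≤ finrank F (C i)) :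
    ∃ u : Fin n → V, LinearIndependent F u ∧ ∀ i, u i ∈ C i := by
  induction n with
  | zero => exact ⟨Fin.elim0, linearIndependent_empty_type, fun i => i.elim0⟩
  | succ n ih =>
    obtain ⟨u, hu, huC⟩ := ih (fun i => C i.castSucc) (fun i => by simpa using hC i.castSucc)
    have hlt : ¬ C (Fin.last n) ≤ Submodule.span F (Set.range u) := by
      intro hle
      have h1 := Submodule.finrank_mono hle
      rw [finrank_span_eq_card hu, Fintype.card_fin] at h1
      have h2 := hC (Fin.last n)
      simp only [Fin.val_last] at h2
      omega
    obtain ⟨x, hx, hxu⟩ := SetLike.not_le_iff_exists.1 hlt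
    refine ⟨Fin.snoc u x, hu.finSnoc hxu, fun i => ?_⟩
    induction i using Fin.lastCases with
    | last => simpa using hx
    | cast i => simpa using huC i

theorem le_finrank_span_inf [FiniteDimensional F V] {n : ℕ} {w : Fin n → V}
    (hw : LinearIndependent F w) (W : Submodule F V) (i : Fin n) (h : ∀ j ≤ i, w j ∈ W) :
    (i : ℕ) + 1 ≤ finrank F ↥(Submodule.span F (Set.range w) ⊓ W) := by
  have hi : (i : ℕ) + 1 ≤ n := i.2
  have h1 : LinearIndependent F (fun j : Fin (i + 1) => w (Fin.castLE hi j)) :=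
    hw.comp _ (Fin.castLE_injective hi)
  have h2 := finrank_span_eq_card h1
  rw [Fintype.card_fin] at h2
  rw [← h2]
  refine Submodule.finrank_mono (Submodule.span_le.2 ?_)
  rintro _ ⟨j, rfl⟩
  refine ⟨Submodule.subset_span ⟨_, rfl⟩, h _ ?_⟩
  rw [Fin.le_def]
  simpa using Nat.lt_succ_iff.1 j.2

theorem finrank_add_le_finrank_inf_add [FiniteDimensional F V] {L W T : Submodule F V}
    (hL : L ≤ T) (hW : W ≤ T) :
    finrank F L + finrank F W ≤ finrank F ↥(L ⊓ W) + finrank F T := by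
  have h1 := Submodule.finrank_sup_add_finrank_inf_eq L W
  have h2 := Submodule.finrank_mono (sup_le hL hW)
  omega

theorem linearIndependent_of_apply_ne_zero {n : ℕ} {φ : V [⋀^Fin n]→ₗ[F] F} {v : Fin n → V}
    (h : φ v ≠ 0) : LinearIndependent F v :=
  not_imp_comm.1 (φ.map_linearDependent v) h

theorem eq_zero_of_mem_span_of_map_eq_zero {V' : Type*} [AddCommGroup V'] [Module F V']
    {n : ℕ} {v : Fin n → V} {g : V →ₗ[F] V'} (h : LinearIndependent F (fun i => g (v i)))
    {x : V} (hx : x ∈ Submodule.span F (Set.range v)) (hgx : g x = 0) : x = 0 := by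
  obtain ⟨c, rfl⟩ := (Submodule.mem_span_range_iff_exists_fun F).1 hx
  rw [map_sum] at hgx
  simp only [map_smul] at hgx
  have := Fintype.linearIndependent_iff.1 h c hgx
  simp [this]

/-- An alternating form of degree `ℓ` does not vanish identically on `L`. -/
def NonzeroOn {ℓ : ℕ} (φ : V [⋀^Fin ℓ]→ₗ[F] F) (L : Submodule F V) : Prop :=
  ∃ v : Fin ℓ → V, (∀ i, v i ∈ L) ∧ φ v ≠ 0

/-- A form of top degree on `L` is determined by its value on one basis, so nonvanishing may be
tested on any basis. -/
theorem NonzeroOn.apply_ne_zero {ℓ : ℕ} {φ : V [⋀^Fin ℓ]→ₗ[F] F} {L : Submodule F V}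
    (h : NonzeroOn φ L) {v : Fin ℓ → V} (hv : LinearIndependent F v)
    (hL : Submodule.span F (Set.range v) = L) : φ v ≠ 0 := by
  subst hL
  intro h0
  have key : φ.compLinearMap (Submodule.span F (Set.range v)).subtype = 0 := by
    refine Basis.ext_alternating (Basis.span hv) fun w hw => ?_
    let σ : Equiv.Perm (Fin ℓ) := Equiv.ofBijective w (Finite.injective_iff_bijective.1 hw)
    have h1 : φ (v ∘ σ) = 0 := by rw [φ.map_perm, h0, smul_zero]
    rw [AlternatingMap.compLinearMap_apply, AlternatingMap.zero_apply, ← h1]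
    congr 1
    funext i
    simp [σ, Basis.span_apply]
  obtain ⟨u, hu, hu0⟩ := h
  exact hu0 (congrArg (fun ψ => ψ (fun i => ⟨u i, hu i⟩)) key)

/-- The points of the Schubert variety on which the form `φ` does not vanish. -/
def support {ℓ : ℕ} (A : Fin ℓ → Submodule F V) (φ : V [⋀^Fin ℓ]→ₗ[F] F) :
    Set (Submodule F V) :=
  {L | L ∈ schubertVariety A ∧ NonzeroOn φ L}

theorem span_range_eq_of_finrank [FiniteDimensional F V] {ℓ : ℕ} {v : Fin ℓ → V}
    (hv : LinearIndependent F v) {L : Submodule F V} (hvL : ∀ i, v i ∈ L)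
    (hL : finrank F L = ℓ) : Submodule.span F (Set.range v) = L := by
  refine Submodule.eq_of_le_of_finrank_eq (Submodule.span_le.2 ?_) ?_
  · rintro _ ⟨i, rfl⟩
    exact hvL i
  · rw [finrank_span_eq_card hv, Fintype.card_fin, hL]

theorem exists_adapted_tuple [FiniteDimensional F V] {ℓ : ℕ} {A : Fin ℓ → Submodule F V}
    {L : Submodule F V} (hL : L ∈ schubertVariety A) :
    ∃ v : Fin ℓ → V, LinearIndependent F v ∧ (∀ i, v i ∈ A i) ∧ (∀ i, v i ∈ L) ∧
      Submodule.span F (Set.range v) = L := by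
  obtain ⟨v, hv, hvL⟩ := exists_linearIndependent_mem (fun i => L ⊓ A i) hL.2
  exact ⟨v, hv, fun i => (hvL i).2, fun i => (hvL i).1,
    span_range_eq_of_finrank hv (fun i => (hvL i).1) hL.1⟩

theorem span_mem_support [FiniteDimensional F V] {ℓ : ℕ} {A : Fin ℓ → Submodule F V}
    {φ : V [⋀^Fin ℓ]→ₗ[F] F} {v : Fin ℓ → V} (hv : φ v ≠ 0)
    (h : ∀ i : Fin ℓ, (i : ℕ) + 1 ≤ finrank F ↥(Submodule.span F (Set.range v) ⊓ A i)) :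
    Submodule.span F (Set.range v) ∈ support A φ := by
  refine ⟨⟨?_, h⟩, v, fun i => Submodule.subset_span ⟨i, rfl⟩, hv⟩
  rw [finrank_span_eq_card (linearIndependent_of_apply_ne_zero hv), Fintype.card_fin]

theorem span_mem_support_of_mem [FiniteDimensional F V] {ℓ : ℕ} {A : Fin ℓ → Submodule F V}
    (hA : Monotone A) {φ : V [⋀^Fin ℓ]→ₗ[F] F} {v : Fin ℓ → V} (hv : φ v ≠ 0)
    (hvA : ∀ i, v i ∈ A i) : Submodule.span F (Set.range v) ∈ support A φ :=
  span_mem_support hv fun i => le_finrank_span_inf (linearIndependent_of_apply_ne_zero hv) _ i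
    fun j hj => hA hj (hvA j)

theorem exists_tuple_of_mem_support [FiniteDimensional F V] {ℓ : ℕ} {A : Fin ℓ → Submodule F V}
    {φ : V [⋀^Fin ℓ]→ₗ[F] F} {L : Submodule F V} (hL : L ∈ support A φ) :
    ∃ v : Fin ℓ → V, φ v ≠ 0 ∧ (∀ i, v i ∈ A i) ∧ (∀ i, v i ∈ L) := by
  obtain ⟨v, hv, hvA, hvL, hs⟩ := exists_adapted_tuple hL.1
  exact ⟨v, hL.2.apply_ne_zero hv hs, hvA, hvL⟩

end LinearAlgebra

/-! ### Double counting of points not contained in the penultimate space. -/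

section Counting

variable {F V : Type*} [Field F] [AddCommGroup V] [Module F V]

/-- Double counting of the pairs `(x, L')` with `x ∈ X` and `L'` in the support of `φ(x, ·)`:
each `L` not contained in `B` arises from at most `q^(ℓ+1) - q^ℓ` of them as `L = L' + ⟨x⟩`. -/
theorem card_mul_le_ncard_support [Finite F] [FiniteDimensional F V] {ℓ : ℕ}
    {A : Fin (ℓ + 1) → Submodule F V} (φ : V [⋀^Fin (ℓ + 1)]→ₗ[F] F) {B : Submodule F V}
    (hBA : B ≤ A (Fin.last ℓ))
    (hB : ∀ L' ∈ schubertVariety (fun i : Fin ℓ => A i.castSucc), L' ≤ B)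
    (X : Set V) (hXA : ∀ x ∈ X, x ∈ A (Fin.last ℓ)) (hXB : ∀ x ∈ X, x ∉ B) (M : ℕ)
    (hM : ∀ x ∈ X, M ≤ (support (fun i : Fin ℓ => A i.castSucc) (φ.curryLeft x)).ncard) :
    X.ncard * M ≤ {L ∈ support A φ | ¬ L ≤ B}.ncard *
      (Nat.card F ^ (ℓ + 1) - Nat.card F ^ ℓ) := by
  classical
  have : Finite V := Module.finite_of_finite F
  set A' : Fin ℓ → Submodule F V := fun i => A i.castSucc with hA'
  have hXf : X.Finite := X.toFinite
  set S := {L ∈ support A φ | ¬ L ≤ B} with hS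
  have hSf : S.Finite := S.toFinite
  have hTf : ∀ x, (support A' (φ.curryLeft x)).Finite := fun x => Set.toFinite _
  let Pi : Finset (Σ _ : V, Submodule F V) := hXf.toFinset.sigma fun x => (hTf x).toFinset
  have hlow : X.ncard * M ≤ Pi.card := by
    rw [Finset.card_sigma, Set.ncard_eq_toFinset_card X hXf, ← smul_eq_mul]
    refine Finset.card_nsmul_le_sum _ _ _ fun x hx => ?_
    rw [← Set.ncard_eq_toFinset_card _ (hTf x)]
    exact hM x (hXf.mem_toFinset.1 hx)
  have hmem : ∀ p ∈ Pi, p.1 ∈ X ∧ p.2 ∈ support A' (φ.curryLeft p.1) := by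
    intro p hp
    simpa [Pi] using hp
  have hmaps : ∀ p ∈ Pi, p.2 ⊔ Submodule.span F {p.1} ∈ hSf.toFinset := by
    rintro ⟨x, L'⟩ hp
    obtain ⟨hx, hL'⟩ := hmem _ hp
    obtain ⟨v, hv0, hvA, hvL⟩ := exists_tuple_of_mem_support hL'
    simp only at hx hL' hv0 hvL ⊢
    have hw0 : φ (Matrix.vecCons x v) ≠ 0 := hv0
    have hwli := linearIndependent_of_apply_ne_zero hw0
    have hspan : Submodule.span F (Set.range (Matrix.vecCons x v)) =
        L' ⊔ Submodule.span F {x} := by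
      have : Set.range (Matrix.vecCons x v) = insert x (Set.range v) := by
        simp [Matrix.vecCons, Fin.range_cons]
      rw [this, Submodule.span_insert, sup_comm,
        span_range_eq_of_finrank (linearIndependent_of_apply_ne_zero hv0) hvL hL'.1.1]
    rw [Set.Finite.mem_toFinset]
    refine ⟨?_, fun hle => hXB x hx (hle (Submodule.mem_sup_right
      (Submodule.mem_span_singleton_self x)))⟩
    have hfin : finrank F ↥(L' ⊔ Submodule.span F {x}) = ℓ + 1 := by
      rw [← hspan, finrank_span_eq_card hwli, Fintype.card_fin]
    rw [← hspan]
    refine span_mem_support hw0 fun i => ?_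
    rw [hspan]
    induction i using Fin.lastCases with
    | last =>
      have hle : L' ⊔ Submodule.span F {x} ≤ A (Fin.last ℓ) :=
        sup_le ((hB L' hL'.1).trans hBA)
          ((Submodule.span_singleton_le_iff_mem _ _).2 (hXA x hx))
      rw [inf_eq_left.2 hle, hfin, Fin.val_last]
    | cast i =>
      exact (hL'.1.2 i).trans (Submodule.finrank_mono (inf_le_inf_right _ le_sup_left))
  have hup := Finset.card_le_mul_card_image_of_maps_to
    (f := fun p : (Σ _ : V, Submodule F V) => p.2 ⊔ Submodule.span F {p.1})
    (s := Pi) (t := hSf.toFinset) hmaps (Nat.card F ^ (ℓ + 1) - Nat.card F ^ ℓ) (by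
      intro L hL
      -- `L ⊓ B` is proper in `L` and contains `L'`, so dimensions force `L' = L ⊓ B`: a pair over
      -- `L` is determined by its vector `x`, which lies in `L` outside `B`.
      have hfib : ∀ p ∈ Pi.filter (fun p => p.2 ⊔ Submodule.span F {p.1} = L),
          p.1 ∈ (L : Set V) \ (L ⊓ B : Submodule F V) ∧ p.2 = L ⊓ B ∧
            finrank F ↥(L ⊓ B) = ℓ ∧ finrank F L = ℓ + 1 := by
        rintro ⟨x, L'⟩ hp
        obtain ⟨hp, hpL⟩ := Finset.mem_filter.1 hp
        obtain ⟨hx, hL'⟩ := hmem _ hp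
        have hLS := hSf.mem_toFinset.1 hL
        simp only at hx hL' hpL ⊢
        have hxL : x ∈ L := by
          rw [← hpL]
          exact Submodule.mem_sup_right (Submodule.mem_span_singleton_self x)
        have hL'L : L' ≤ L ⊓ B := le_inf (by rw [← hpL]; exact le_sup_left) (hB L' hL'.1)
        have hlt : L ⊓ B < L := lt_of_le_of_ne inf_le_left
          (fun h => hLS.2 (inf_eq_left.1 h))
        have h1 := Submodule.finrank_lt_finrank_of_lt hlt
        have h2 := Submodule.finrank_mono hL'L
        have h3 := hLS.1.1.1
        have h4 := hL'.1.1
        have h5 : L' = L ⊓ B := Submodule.eq_of_le_of_finrank_le hL'L (by omega)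
        exact ⟨⟨hxL, fun h => hXB x hx h.2⟩, h5, by rw [← h5]; exact h4, h3⟩
      rcases (Pi.filter (fun p => p.2 ⊔ Submodule.span F {p.1} = L)).eq_empty_or_nonempty
        with he | ⟨p0, hp0⟩
      · rw [he]; simp
      · obtain ⟨-, -, h1, h2⟩ := hfib p0 hp0
        have hcard : ((L : Set V) \ (L ⊓ B : Submodule F V)).ncard =
            Nat.card F ^ (ℓ + 1) - Nat.card F ^ ℓ := by
          rw [Set.ncard_sdiff (fun _ h => (Submodule.mem_inf.1 h).1), ncard_coe_submodule,
            ncard_coe_submodule, h1, h2]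
        rw [← hcard, Set.ncard_eq_toFinset_card _ (Set.toFinite _)]
        refine Finset.card_le_card_of_injOn (fun p => p.1) (fun p hp => ?_) ?_
        · exact (Set.Finite.mem_toFinset _).2 (hfib p hp).1
        · rintro ⟨x, L₁⟩ hp ⟨y, L₂⟩ hp' hxy
          have e1 := (hfib _ hp).2.1
          have e2 := (hfib _ hp').2.1
          simp only at hxy e1 e2
          rw [hxy, e1, e2])
  rw [← Set.ncard_eq_toFinset_card S hSf] at hup
  rw [mul_comm S.ncard]
  exact hlow.trans hup

end Counting

/-! ### The kernel `K` in the last space, and the case of a small union `B ∪ K`. -/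

section Kernel

variable {F V : Type*} [Field F] [AddCommGroup V] [Module F V]

/-- The vectors of the last space of the flag whose contraction with `φ` vanishes on the product
of the earlier spaces. -/
def lastKernel {ℓ : ℕ} (A : Fin (ℓ + 1) → Submodule F V) (φ : V [⋀^Fin (ℓ + 1)]→ₗ[F] F) :
    Submodule F V where
  carrier := {x | x ∈ A (Fin.last ℓ) ∧
    ∀ v : Fin ℓ → V, (∀ i, v i ∈ A i.castSucc) → φ.curryLeft x v = 0}
  add_mem' := fun {x y} hx hy => ⟨add_mem hx.1 hy.1, fun v hv => by
    rw [map_add, AlternatingMap.add_apply, hx.2 v hv, hy.2 v hv, add_zero]⟩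
  zero_mem' := ⟨zero_mem _, fun v _ => by rw [map_zero, AlternatingMap.zero_apply]⟩
  smul_mem' := fun c x hx => ⟨Submodule.smul_mem _ c hx.1, fun v hv => by
    rw [map_smul, AlternatingMap.smul_apply, hx.2 v hv, smul_zero]⟩

theorem lastKernel_le {ℓ : ℕ} (A : Fin (ℓ + 1) → Submodule F V)
    (φ : V [⋀^Fin (ℓ + 1)]→ₗ[F] F) : lastKernel A φ ≤ A (Fin.last ℓ) := fun _ hx => hx.1

theorem apply_snoc_eq_zero {ℓ : ℕ} {φ : V [⋀^Fin (ℓ + 1)]→ₗ[F] F} {v : Fin ℓ → V} {x : V}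
    (h : φ.curryLeft x v = 0) : φ (Fin.snoc v x) = 0 := by
  have h1 : φ ((Matrix.vecCons x v) ∘ finRotate (ℓ + 1)) = 0 := by
    rw [φ.map_perm]
    have : φ (Matrix.vecCons x v) = 0 := h
    rw [this, smul_zero]
  rw [← h1]
  congr 1
  exact Fin.snoc_eq_cons_rotate v x

theorem apply_update_last_eq_zero {ℓ : ℕ} {A : Fin (ℓ + 1) → Submodule F V}
    {φ : V [⋀^Fin (ℓ + 1)]→ₗ[F] F} {v : Fin (ℓ + 1) → V} {x : V} (hx : x ∈ lastKernel A φ)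
    (hv : ∀ i : Fin ℓ, v i.castSucc ∈ A i.castSucc) :
    φ (Function.update v (Fin.last ℓ) x) = 0 := by
  have h := apply_snoc_eq_zero (hx.2 (fun i => v i.castSucc) hv)
  rw [← h]
  congr 1
  funext i
  induction i using Fin.lastCases with
  | last => simp
  | cast i => simp [(Fin.castSucc_lt_last i).ne]

/-- Otherwise the last vector of an adapted basis of a support point would lie in the kernel and
make `φ` vanish there. -/
theorem lastKernel_lt [FiniteDimensional F V] {ℓ : ℕ} {A : Fin (ℓ + 1) → Submodule F V}
    {φ : V [⋀^Fin (ℓ + 1)]→ₗ[F] F} (h : (support A φ).Nonempty) :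
    lastKernel A φ < A (Fin.last ℓ) := by
  refine lt_of_le_of_ne (lastKernel_le A φ) fun heq => ?_
  obtain ⟨L, hL⟩ := h
  obtain ⟨v, hv0, hvA, -⟩ := exists_tuple_of_mem_support hL
  refine hv0 ?_
  have := apply_update_last_eq_zero (A := A) (φ := φ) (v := v) (x := v (Fin.last ℓ))
    (by rw [heq]; exact hvA _) (fun i => hvA _)
  rwa [Function.update_eq_self] at this

theorem le_last_of_mem_schubertVariety [FiniteDimensional F V] {ℓ : ℕ}
    {A : Fin (ℓ + 1) → Submodule F V} {L : Submodule F V} (hL : L ∈ schubertVariety A) :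
    L ≤ A (Fin.last ℓ) := by
  have h1 := hL.2 (Fin.last ℓ)
  have h2 := hL.1
  have : L ⊓ A (Fin.last ℓ) = L :=
    Submodule.eq_of_le_of_finrank_le inf_le_left (by rw [h2]; simpa using h1)
  exact inf_eq_left.1 this

/-- If `φ` does not vanish on tuples whose last two vectors lie in the penultimate space, then
`lastKernel` has codimension at least two. -/
theorem finrank_lastKernel_add_two_le [FiniteDimensional F V] {r : ℕ}
    {A : Fin (r + 1 + 1) → Submodule F V} (hA : Monotone A) {φ : V [⋀^Fin (r + 1 + 1)]→ₗ[F] F}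
    (h : ¬ A (Fin.last r).castSucc ≤ lastKernel A φ) :
    finrank F (lastKernel A φ) + 2 ≤ finrank F (A (Fin.last (r + 1))) := by
  by_contra! hlt
  obtain ⟨y, hyB, hyK⟩ := SetLike.not_le_iff_exists.1 h
  have hBT : A (Fin.last r).castSucc ≤ A (Fin.last (r + 1)) := hA (Fin.le_last _)
  have hle : lastKernel A φ ⊔ Submodule.span F {y} ≤ A (Fin.last (r + 1)) :=
    sup_le (lastKernel_le A φ) ((Submodule.span_singleton_le_iff_mem _ _).2 (hBT hyB))
  have hlt' : lastKernel A φ < lastKernel A φ ⊔ Submodule.span F {y} :=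
    lt_of_le_of_ne le_sup_left fun he => hyK (by
      rw [he]; exact Submodule.mem_sup_right (Submodule.mem_span_singleton_self y))
  have heq := Submodule.eq_of_le_of_finrank_le hle
    (by have := Submodule.finrank_lt_finrank_of_lt hlt'; omega)
  refine hyK ⟨hBT hyB, fun v hv => ?_⟩
  -- In codimension at most one the kernel and `y` span the last space. Splitting the last entry of
  -- `v` accordingly, the `y` part drops out of `φ(y, v)` because `y` is repeated.
  have hw : v (Fin.last r) ∈ lastKernel A φ ⊔ Submodule.span F {y} := by
    rw [heq]; exact hBT (hv _)
  obtain ⟨k, hk, z, hz, hkz⟩ := Submodule.mem_sup.1 hw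
  obtain ⟨c, rfl⟩ := Submodule.mem_span_singleton.1 hz
  set t : Fin (r + 1 + 1) → V := Matrix.vecCons y v with ht
  set j : Fin (r + 1 + 1) := Fin.last (r + 1) with hj
  have hj0 : j ≠ 0 := (Fin.last_pos).ne'
  have htj : t j = k + c • y := by
    rw [hkz, ht, hj, ← Fin.succ_last, Matrix.cons_val_succ]
  have h1 : φ t = φ (Function.update t j k) := by
    conv_lhs => rw [← Function.update_eq_self j t, htj, φ.map_update_add, φ.map_update_smul]
    have : φ (Function.update t j y) = 0 := φ.map_update_self t hj0
    rw [this, smul_zero, add_zero]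
  -- After the swap `k` is in front and `y` takes the penultimate position, where it is allowed
  -- since it lies in the penultimate space.
  have h2 : φ (Function.update t j k ∘ Equiv.swap 0 j) = 0 := by
    have := hk.2 (Function.update v (Fin.last r) y) (fun i => by
      by_cases hi : i = Fin.last r
      · subst hi; simpa using hyB
      · rw [Function.update_of_ne hi]; exact hv i)
    rw [← this, AlternatingMap.curryLeft_apply_apply]
    congr 1
    funext i
    induction i using Fin.cases with
    | zero => simp
    | succ i =>
      by_cases hi : i = Fin.last r
      · subst hi
        have : (Fin.last r).succ = j := rfl
        simp only [Function.comp_apply, this, Equiv.swap_apply_right, ht]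
        rw [Function.update_of_ne hj0.symm, ← this, Matrix.cons_val_succ, Function.update_self,
          Matrix.cons_val_zero]
      · have h3 : i.succ ≠ j := fun h => hi (Fin.succ_injective _ h)
        simp [Equiv.swap_apply_of_ne_of_ne (Fin.succ_ne_zero i) h3, h3, hi, ht]
  rw [φ.map_swap _ hj0.symm, neg_eq_zero] at h2
  change φ t = 0
  rw [h1, h2]

theorem delta_succ {ℓ : ℕ} (A : Fin (ℓ + 1) → Submodule F V) :
    delta A = delta (fun i : Fin ℓ => A i.castSucc) +
      (finrank F (A (Fin.last ℓ)) - (ℓ + 1)) := by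
  simp [delta, Fin.sum_univ_castSucc]

theorem card_sdiff_mul_le [Finite F] [FiniteDimensional F V] {ℓ : ℕ}
    {A : Fin (ℓ + 1) → Submodule F V} (hA : Monotone A) (φ : V [⋀^Fin (ℓ + 1)]→ₗ[F] F)
    {B : Submodule F V} (hBA : B ≤ A (Fin.last ℓ))
    (hB : ∀ L' ∈ schubertVariety (fun i : Fin ℓ => A i.castSucc), L' ≤ B) (M : ℕ)
    (ih : ∀ ψ : V [⋀^Fin ℓ]→ₗ[F] F, (support (fun i : Fin ℓ => A i.castSucc) ψ).Nonempty →
      M ≤ (support (fun i : Fin ℓ => A i.castSucc) ψ).ncard) :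
    ((A (Fin.last ℓ) : Set V) \ (B ∪ lastKernel A φ)).ncard * M ≤
      {L ∈ support A φ | ¬ L ≤ B}.ncard * (Nat.card F ^ (ℓ + 1) - Nat.card F ^ ℓ) := by
  refine card_mul_le_ncard_support φ hBA hB _ (fun x hx => hx.1) (fun x hx h => hx.2 (Or.inl h))
    M fun x hx => ih _ ?_
  have hxK : ¬ ∀ v : Fin ℓ → V, (∀ i, v i ∈ A i.castSucc) → φ.curryLeft x v = 0 :=
    fun h => hx.2 (Or.inr ⟨hx.1, h⟩)
  push Not at hxK
  obtain ⟨v, hv, hv0⟩ := hxK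
  exact ⟨_, span_mem_support_of_mem (fun i j hij => hA (Fin.castSucc_le_castSucc_iff.2 hij))
    hv0 hv⟩

theorem one_lt_natCard [Finite F] : 1 < Nat.card F := Finite.one_lt_card

/-- The threshold is the size of a hyperplane of the last space: removing at most that many vectors
leaves exactly what the double count needs, without using points inside `B`. -/
theorem pow_delta_le_of_union_le [Finite F] [FiniteDimensional F V] {ℓ : ℕ}
    {A : Fin (ℓ + 1) → Submodule F V} (hA : Monotone A) {φ : V [⋀^Fin (ℓ + 1)]→ₗ[F] F}
    (hφ : (support A φ).Nonempty)
    {B : Submodule F V} (hBA : B ≤ A (Fin.last ℓ))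
    (hB : ∀ L' ∈ schubertVariety (fun i : Fin ℓ => A i.castSucc), L' ≤ B)
    (ih : ∀ ψ : V [⋀^Fin ℓ]→ₗ[F] F, (support (fun i : Fin ℓ => A i.castSucc) ψ).Nonempty →
      Nat.card F ^ delta (fun i : Fin ℓ => A i.castSucc) ≤
        (support (fun i : Fin ℓ => A i.castSucc) ψ).ncard)
    (hun : ((B : Set V) ∪ lastKernel A φ).ncard ≤
      Nat.card F ^ (finrank F (A (Fin.last ℓ)) - 1)) :
    Nat.card F ^ delta A ≤ (support A φ).ncard := by
  have : Finite V := Module.finite_of_finite F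
  have key := card_sdiff_mul_le hA φ hBA hB _ ih
  obtain ⟨L, hL⟩ := hφ
  have hle := Submodule.finrank_mono (le_last_of_mem_schubertVariety hL.1)
  rw [hL.1.1] at hle
  have hsub : {L ∈ support A φ | ¬ L ≤ B}.ncard ≤ (support A φ).ncard :=
    Set.ncard_le_ncard (fun _ h => h.1) (Set.toFinite _)
  rw [Set.ncard_sdiff (Set.union_subset hBA (lastKernel_le A φ)) (Set.toFinite _),
    ncard_coe_submodule] at key
  rw [delta_succ]
  obtain ⟨d, hd⟩ := Nat.exists_eq_add_of_le hle
  set q := Nat.card F with hq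
  have hq1 : 1 < q := one_lt_natCard
  set D := delta (fun i : Fin ℓ => A i.castSucc)
  rw [hd] at hun key ⊢
  have e1 : ℓ + 1 + d - 1 = ℓ + d := by omega
  have e2 : ℓ + 1 + d - (ℓ + 1) = d := by omega
  rw [e1] at hun
  rw [e2]
  have h1 : (q - 1) * q ^ ℓ * q ^ (D + d) ≤ (q - 1) * q ^ ℓ * (support A φ).ncard := by
    calc (q - 1) * q ^ ℓ * q ^ (D + d) = (q ^ (ℓ + 1 + d) - q ^ (ℓ + d)) * q ^ D := by
          have : q ^ (ℓ + 1 + d) - q ^ (ℓ + d) = (q - 1) * q ^ (ℓ + d) := by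
            rw [Nat.sub_mul, one_mul]; congr 1; ring
          rw [this]; ring
      _ ≤ (q ^ (ℓ + 1 + d) - ((B : Set V) ∪ lastKernel A φ).ncard) * q ^ D :=
          Nat.mul_le_mul_right _ (Nat.sub_le_sub_left hun _)
      _ ≤ _ := key
      _ ≤ (support A φ).ncard * (q ^ (ℓ + 1) - q ^ ℓ) := Nat.mul_le_mul_right _ hsub
      _ = _ := by
          have : q ^ (ℓ + 1) - q ^ ℓ = (q - 1) * q ^ ℓ := by
            rw [Nat.sub_mul, one_mul]; congr 1; ring
          rw [this]; ring
  exact Nat.le_of_mul_le_mul_left h1 (Nat.mul_pos (by omega) (Nat.pow_pos (by omega)))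

end Kernel

/-! ### Flags: interpolation of subspaces and lowering of the last block. -/

section Flags

variable {F V : Type*} [Field F] [AddCommGroup V] [Module F V]

theorem exists_submodule_between [FiniteDimensional F V] {W T : Submodule F V} (hWT : W ≤ T)
    {d : ℕ} (hWd : finrank F W ≤ d) (hdT : d ≤ finrank F T) :
    ∃ H : Submodule F V, W ≤ H ∧ H ≤ T ∧ finrank F H = d := by
  induction d, hWd using Nat.le_induction with
  | base => exact ⟨W, le_rfl, hWT, rfl⟩
  | succ d hd ih =>
    obtain ⟨H, hWH, hHT, hH⟩ := ih (by omega)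
    have hlt : ¬ T ≤ H := fun h => by have := Submodule.finrank_mono h; omega
    obtain ⟨y, hyT, hyH⟩ := SetLike.not_le_iff_exists.1 hlt
    refine ⟨H ⊔ Submodule.span F {y}, hWH.trans le_sup_left,
      sup_le hHT ((Submodule.span_singleton_le_iff_mem _ _).2 hyT), ?_⟩
    have h1 : H < H ⊔ Submodule.span F {y} := lt_of_le_of_ne le_sup_left fun he => hyH (by
      rw [he]; exact Submodule.mem_sup_right (Submodule.mem_span_singleton_self y))
    have h2 := Submodule.finrank_lt_finrank_of_lt h1
    have h3 := Submodule.finrank_add_le_finrank_add_finrank H (Submodule.span F {y})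
    have h4 := finrank_span_singleton (K := F) (v := y) fun h => hyH (h ▸ zero_mem H)
    omega

theorem finrank_add_sub_le [FiniteDimensional F V] {n : ℕ} {A : Fin n → Submodule F V}
    (hA : StrictMono A) {i j : Fin n} (hij : i ≤ j) :
    finrank F (A i) + (j - i : ℕ) ≤ finrank F (A j) := by
  obtain ⟨i, hi⟩ := i
  obtain ⟨j, hj⟩ := j
  simp only [Fin.mk_le_mk] at hij ⊢
  induction j, hij using Nat.le_induction with
  | base => simp
  | succ j hij ih =>
    have h1 := ih (by omega)
    have h2 : A ⟨j, by omega⟩ < A ⟨j + 1, hj⟩ := hA (by simp [Fin.lt_def])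
    have h3 := Submodule.finrank_lt_finrank_of_lt h2
    omega

/-- Lowering the last block of consecutive dimensions of a flag by one. -/
theorem exists_lowered_flag [FiniteDimensional F V] {n : ℕ} {A : Fin n → Submodule F V}
    (hA : StrictMono A) (k : Fin n) (hk0 : 1 ≤ finrank F (A k))
    (hk : ∀ i, k ≤ i → finrank F (A i) = finrank F (A k) + (i - k : ℕ))
    (hgap : ∀ i, i < k → finrank F (A i) + 2 ≤ finrank F (A k)) :
    ∃ A' : Fin n → Submodule F V, StrictMono A' ∧ (∀ i, A' i ≤ A i) ∧
      (∀ i, i < k → A' i = A i) ∧ (∀ i, k ≤ i → finrank F (A' i) + 1 = finrank F (A i)) ∧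
      ∀ i j : Fin n, k < i → (j : ℕ) + 1 = i → A' i = A j := by
  obtain ⟨H, hH1, hHk, hH⟩ : ∃ H : Submodule F V, (∀ i, i < k → A i < H) ∧ H ≤ A k ∧
      finrank F H + 1 = finrank F (A k) := by
    obtain ⟨W, hW, hW1, hW2⟩ : ∃ W : Submodule F V, (∀ i, i < k → A i ≤ W) ∧ W ≤ A k ∧
        finrank F W ≤ finrank F (A k) - 1 := by
      by_cases h0 : (k : ℕ) = 0
      · exact ⟨⊥, fun i hi => absurd (Fin.lt_def.1 hi) (by omega), bot_le, by simp⟩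
      · have hlt : (⟨k - 1, by omega⟩ : Fin n) < k := by rw [Fin.lt_def]; simp only; omega
        refine ⟨A ⟨k - 1, by omega⟩, fun i hi => hA.monotone ?_, (hA hlt).le, ?_⟩
        · rw [Fin.le_def]; rw [Fin.lt_def] at hi; simp only; omega
        · have := hgap _ hlt; omega
    obtain ⟨H, h1, h2, h3⟩ := exists_submodule_between hW1 hW2 (Nat.sub_le _ 1)
    refine ⟨H, fun i hi => lt_of_le_of_ne ((hW i hi).trans h1) fun he => ?_, h2, by omega⟩
    have := hgap i hi
    rw [he] at this
    omega
  have hHlt : H < A k := lt_of_le_of_ne hHk fun he => by rw [he] at hH; omega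
  -- From `k` on the flag is shifted by one place, and the vacant place `k` is filled by a
  -- hyperplane `H` of `A k` containing all earlier spaces; the gap before `k` keeps the inclusions
  -- strict.
  let A' : Fin n → Submodule F V := fun i =>
    if i < k then A i else if i = k then H else A ⟨i - 1, by omega⟩
  have a1 : ∀ i, i < k → A' i = A i := fun i hi => if_pos hi
  have a2 : A' k = H := by simp [A']
  have a3 : ∀ i j : Fin n, k < i → (j : ℕ) + 1 = i → A' i = A j := fun i j hi hj => by
    simp only [A', if_neg hi.asymm, if_neg hi.ne']
    congr 1
    ext
    simp only
    omega
  have hpred : ∀ i, k < i → ∃ j : Fin n, (j : ℕ) + 1 = i ∧ k ≤ j ∧ j < i := fun i hi => by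
    rw [Fin.lt_def] at hi
    refine ⟨⟨i - 1, by omega⟩, ?_, ?_, ?_⟩
    · simp only; omega
    · rw [Fin.le_def]; simp only; omega
    · rw [Fin.lt_def]; simp only; omega
  refine ⟨A', fun i j hij => ?_, fun i => ?_, a1, fun i hi => ?_, a3⟩
  · rcases lt_trichotomy j k with hj | hj | hj
    · rw [a1 i (hij.trans hj), a1 j hj]; exact hA hij
    · subst hj; rw [a1 i hij, a2]; exact hH1 i hij
    · obtain ⟨j', e1, e2, e3⟩ := hpred j hj
      rw [a3 j j' hj e1]
      rcases lt_trichotomy i k with hi | hi | hi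
      · rw [a1 i hi]; exact hA (hi.trans_le e2)
      · rw [hi, a2]; exact hHlt.trans_le (hA.monotone e2)
      · obtain ⟨i', f1, f2, f3⟩ := hpred i hi
        rw [a3 i i' hi f1]
        refine hA ?_
        rw [Fin.lt_def] at hij ⊢
        omega
  · rcases lt_trichotomy i k with hi | hi | hi
    · rw [a1 i hi]
    · rw [hi, a2]; exact hHk
    · obtain ⟨i', f1, f2, f3⟩ := hpred i hi
      rw [a3 i i' hi f1]; exact hA.monotone f3.le
  · rcases hi.eq_or_lt with hi | hi
    · rw [← hi, a2, hH]
    · obtain ⟨i', f1, f2, f3⟩ := hpred i hi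
      rw [a3 i i' hi f1, hk i hi.le, hk i' f2]
      rw [Fin.le_def] at f2
      omega

theorem delta_le_delta_add {n : ℕ} {A A' : Fin n → Submodule F V} (k : Fin n)
    (h1 : ∀ i, i < k → A' i = A i) (h2 : ∀ i, k ≤ i → finrank F (A' i) + 1 = finrank F (A i)) :
    delta A ≤ delta A' + (n - k) := by
  have hc : (n - k : ℕ) = ∑ i : Fin n, if k ≤ i then 1 else 0 := by
    rw [Finset.sum_boole, Nat.cast_id, ← Fin.card_Ici]
    congr 1
    ext i
    simp
  rw [hc, delta, delta, ← Finset.sum_add_distrib]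
  refine Finset.sum_le_sum fun i _ => ?_
  split_ifs with hi
  · have := h2 i hi; omega
  · rw [h1 i (not_le.1 hi)]; omega

end Flags

/-! ### The case where `B` is a hyperplane of the last space and `K ⊄ B`. -/

section HyperplaneCase

variable {F V : Type*} [Field F] [AddCommGroup V] [Module F V] [FiniteDimensional F V]

/-- When the penultimate space is a hyperplane of the last one, `φ` vanishes on every point of
the Schubert variety which contains a vector of `lastKernel` outside that hyperplane. -/
theorem not_nonzeroOn_of_mem_lastKernel {r : ℕ} {A : Fin (r + 1 + 1) → Submodule F V}
    (hA : StrictMono A) {φ : V [⋀^Fin (r + 1 + 1)]→ₗ[F] F}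
    (hB : finrank F (A (Fin.last r).castSucc) + 1 = finrank F (A (Fin.last (r + 1))))
    {z : V} (hz : z ∈ lastKernel A φ) (hzB : z ∉ A (Fin.last r).castSucc)
    {L : Submodule F V} (hL : L ∈ schubertVariety A) (hzL : z ∈ L) : ¬ NonzeroOn φ L := by
  intro hnz
  set B := A (Fin.last r).castSucc with hBdef
  have hBT : B ≤ A (Fin.last (r + 1)) := hA.monotone (Fin.le_last _)
  have hLT := le_last_of_mem_schubertVariety hL
  have h1 := finrank_add_le_finrank_inf_add hLT hBT
  have hlt : L ⊓ B < L := lt_of_le_of_ne inf_le_left fun h => hzB (inf_eq_left.1 h hzL)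
  have h2 := Submodule.finrank_lt_finrank_of_lt hlt
  have h3 := hL.1
  have hmem : L ⊓ B ∈ schubertVariety (fun i : Fin (r + 1) => A i.castSucc) := by
    refine ⟨by omega, fun i => ?_⟩
    have h4 : A i.castSucc ≤ B := hA.monotone (Fin.castSucc_le_castSucc_iff.2 (Fin.le_last i))
    rw [inf_assoc, inf_eq_right.2 h4]
    exact hL.2 i.castSucc
  obtain ⟨v, hv, hvA, hvL, hs⟩ := exists_adapted_tuple hmem
  have hli : LinearIndependent F (Matrix.vecCons z v) :=
    linearIndependent_finCons.2 ⟨hv, fun h => hzB (by rw [hs] at h; exact h.2)⟩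
  refine hnz.apply_ne_zero hli (span_range_eq_of_finrank hli (fun i => ?_) h3) (hz.2 v hvA)
  induction i using Fin.cases with
  | zero => exact hzL
  | succ i => exact (hvL i).1

/-- The last vector of an adapted basis can be changed by an element of the kernel without changing
the value of `φ`, hence moved into the penultimate space. -/
theorem exists_mem_support_le {r : ℕ} {A : Fin (r + 1 + 1) → Submodule F V}
    (hA : StrictMono A) {φ : V [⋀^Fin (r + 1 + 1)]→ₗ[F] F}
    (hφ : (support A φ).Nonempty)
    (hsup : A (Fin.last r).castSucc ⊔ lastKernel A φ = A (Fin.last (r + 1))) :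
    ∃ L ∈ support A φ, L ≤ A (Fin.last r).castSucc := by
  obtain ⟨L, hL⟩ := hφ
  obtain ⟨v, hv0, hvA, -⟩ := exists_tuple_of_mem_support hL
  have hlast := hvA (Fin.last (r + 1))
  rw [← hsup] at hlast
  obtain ⟨b, hb, x, hx, hbx⟩ := Submodule.mem_sup.1 hlast
  have hw0 : φ (Function.update v (Fin.last (r + 1)) b) ≠ 0 := by
    have h1 := φ.map_update_add v (Fin.last (r + 1)) b x
    rw [hbx, Function.update_eq_self,
      apply_update_last_eq_zero hx (fun i => hvA i.castSucc), add_zero] at h1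
    rwa [← h1]
  have hmem : ∀ i : Fin (r + 1 + 1), Function.update v (Fin.last (r + 1)) b i ∈ A i ∧
      Function.update v (Fin.last (r + 1)) b i ∈ A (Fin.last r).castSucc := by
    intro i
    induction i using Fin.lastCases with
    | last =>
      rw [Function.update_self]
      exact ⟨hA.monotone (Fin.le_last _) hb, hb⟩
    | cast i =>
      rw [Function.update_of_ne (Fin.castSucc_lt_last i).ne]
      exact ⟨hvA _, hA.monotone (Fin.castSucc_le_castSucc_iff.2 (Fin.le_last i)) (hvA _)⟩
  refine ⟨_, span_mem_support_of_mem hA.monotone hw0 (fun i => (hmem i).1),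
    Submodule.span_le.2 ?_⟩
  rintro _ ⟨i, rfl⟩
  exact (hmem i).2

/-- If the dimensions of the flag are consecutive from position `k` on, then `lastKernel` has
codimension at least the number of positions from `k` on. -/
theorem finrank_lastKernel_add_le {r : ℕ} {A : Fin (r + 1 + 1) → Submodule F V}
    (hA : StrictMono A) {φ : V [⋀^Fin (r + 1 + 1)]→ₗ[F] F} (hφ : (support A φ).Nonempty)
    (hB : finrank F (A (Fin.last r).castSucc) + 1 = finrank F (A (Fin.last (r + 1))))
    {x : V} (hx : x ∈ lastKernel A φ) (hxB : x ∉ A (Fin.last r).castSucc)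
    (k : Fin (r + 1 + 1))
    (hk : ∀ i, k ≤ i → finrank F (A i) + (r + 1 - i : ℕ) = finrank F (A (Fin.last (r + 1)))) :
    finrank F (lastKernel A φ) + (r + 1 + 1 - k) ≤ finrank F (A (Fin.last (r + 1))) := by
  obtain ⟨L, hL⟩ := hφ
  obtain ⟨v, hv0, hvA, -⟩ := exists_tuple_of_mem_support hL
  have hvT : ∀ i, v i ∈ A (Fin.last (r + 1)) := fun i => hA.monotone (Fin.le_last i) (hvA i)
  have hout : ∀ j, k ≤ j → ∀ z ∈ lastKernel A φ, z ∉ A (Fin.last r).castSucc →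
      φ (Function.update v j z) = 0 := by
    intro j hj z hz hzB
    by_contra hne
    have hwT : Submodule.span F (Set.range (Function.update v j z)) ≤ A (Fin.last (r + 1)) := by
      refine Submodule.span_le.2 ?_
      rintro _ ⟨i, rfl⟩
      by_cases hij : i = j
      · subst hij; rw [Function.update_self]; exact hz.1
      · rw [Function.update_of_ne hij]; exact hvT i
    have hli := linearIndependent_of_apply_ne_zero hne
    -- From `k` on the incidence conditions hold for every subspace of the last space of the right
    -- dimension, and before `k` no vector has been altered.
    have hmem := span_mem_support (A := A) hne fun i => by
      by_cases hi : k ≤ i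
      · have h1 := finrank_add_le_finrank_inf_add hwT (hA.monotone (Fin.le_last i))
        rw [finrank_span_eq_card hli, Fintype.card_fin] at h1
        have h2 := hk i hi
        have h3 := i.2
        omega
      · refine le_finrank_span_inf hli _ i fun i' hi' => ?_
        have : i' ≠ j := ((hi'.trans_lt (not_le.1 hi)).trans_le hj).ne
        rw [Function.update_of_ne this]
        exact hA.monotone hi' (hvA i')
    exact not_nonzeroOn_of_mem_lastKernel hA hB hz hzB hmem.1
      (Submodule.subset_span ⟨j, Function.update_self j z v⟩) hmem.2
  -- For `z` inside the hyperplane, both `z + x` and `x` lie outside it, and additivity gives the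
  -- claim.
  have hall : ∀ j, k ≤ j → ∀ z ∈ lastKernel A φ, φ (Function.update v j z) = 0 := by
    intro j hj z hz
    by_cases hzB : z ∈ A (Fin.last r).castSucc
    · have h1 := hout j hj (z + x) (add_mem hz hx) fun h => hxB (by
        simpa using sub_mem h hzB)
      rwa [φ.map_update_add, hout j hj x hx hxB, add_zero] at h1
    · exact hout j hj z hz hzB
  by_contra! hlt
  have hli := linearIndependent_of_apply_ne_zero hv0
  let u : {i : Fin (r + 1 + 1) // k ≤ i} → V := fun i => v i
  have hu : LinearIndependent F u := hli.comp _ Subtype.val_injective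
  have hcard : Fintype.card {i : Fin (r + 1 + 1) // k ≤ i} = r + 1 + 1 - k := by
    rw [Fintype.card_subtype, ← Fin.card_Ici]
    congr 1
    ext i
    simp
  have hM : Submodule.span F (Set.range u) ≤ A (Fin.last (r + 1)) := by
    refine Submodule.span_le.2 ?_
    rintro _ ⟨i, rfl⟩
    exact hvT i
  have h1 := finrank_add_le_finrank_inf_add hM (lastKernel_le A φ)
  rw [finrank_span_eq_card hu, hcard] at h1
  -- A nonzero kernel vector `y = ∑ c_i v_i` over `i ≥ k`, put in place of a `v_j` with `c_j ≠ 0`,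
  -- gives the value `c_j φ(v) ≠ 0`, against `hall`.
  have hne : Submodule.span F (Set.range u) ⊓ lastKernel A φ ≠ ⊥ := fun h => by
    rw [h, finrank_bot] at h1
    omega
  obtain ⟨y, hy, hy0⟩ := Submodule.exists_mem_ne_zero_of_ne_bot hne
  obtain ⟨c, hc⟩ := (Submodule.mem_span_range_iff_exists_fun F).1 hy.1
  obtain ⟨j, hj⟩ : ∃ j, c j ≠ 0 := by
    by_contra! h0
    refine hy0 ?_
    rw [← hc]
    simp [h0]
  have h2 := hall j j.2 y hy.2
  rw [← hc, φ.map_update_sum, Finset.sum_eq_single j] at h2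
  · rw [φ.map_update_smul, Function.update_eq_self, smul_eq_mul] at h2
    exact (mul_ne_zero hj hv0) h2
  · intro i _ hij
    rw [φ.map_update_smul, φ.map_update_self v (i := j) (j := i) (fun h => hij (Subtype.ext h.symm)),
      smul_zero]
  · intro h; exact absurd (Finset.mem_univ _) h

/-- Here `s` is the length of the last block. It bounds both the loss in `delta` and, from below,
the codimension of the kernel, which is what lets the two counts balance. -/
theorem exists_lowered_support [Finite F] {r : ℕ} {A : Fin (r + 1 + 1) → Submodule F V}
    (hA : StrictMono A) {φ : V [⋀^Fin (r + 1 + 1)]→ₗ[F] F} (hφ : (support A φ).Nonempty)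
    (hB : finrank F (A (Fin.last r).castSucc) + 1 = finrank F (A (Fin.last (r + 1))))
    {x : V} (hx : x ∈ lastKernel A φ) (hxB : x ∉ A (Fin.last r).castSucc)
    (hsup : A (Fin.last r).castSucc ⊔ lastKernel A φ = A (Fin.last (r + 1))) :
    ∃ (A' : Fin (r + 1 + 1) → Submodule F V) (s : ℕ), StrictMono A' ∧
      A' (Fin.last (r + 1)) = A (Fin.last r).castSucc ∧ (support A' φ).Nonempty ∧
      support A' φ ⊆ {L ∈ support A φ | L ≤ A (Fin.last r).castSucc} ∧
      delta A ≤ delta A' + s ∧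
      finrank F (lastKernel A φ) + s ≤ finrank F (A (Fin.last (r + 1))) := by
  obtain ⟨k, hk, hmin⟩ := wellFounded_lt.has_min
    {i : Fin (r + 1 + 1) | finrank F (A i) + (r + 1 - i : ℕ) =
      finrank F (A (Fin.last (r + 1)))}
    ⟨Fin.last (r + 1), by simp⟩
  simp only [Set.mem_ofPred_eq] at hk hmin
  have hle : ∀ i : Fin (r + 1 + 1), finrank F (A i) + (r + 1 - i : ℕ) ≤
      finrank F (A (Fin.last (r + 1))) := fun i =>
    finrank_add_sub_le hA (Fin.le_last i)
  have hk' : ∀ i, k ≤ i → finrank F (A i) + (r + 1 - i : ℕ) =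
      finrank F (A (Fin.last (r + 1))) := by
    intro i hi
    have h1 := finrank_add_sub_le hA hi
    have h2 := hle i
    rw [Fin.le_def] at hi
    have := i.2
    omega
  have hklast : k < Fin.last (r + 1) := by
    have h1 : ¬ (Fin.last r).castSucc < k := fun h => hmin _ (by
      simp only [Fin.val_castSucc, Fin.val_last]
      omega) h
    exact (not_lt.1 h1).trans_lt (Fin.castSucc_lt_last _)
  obtain ⟨L, hL, hLB⟩ := exists_mem_support_le hA hφ hsup
  have hLB' := Submodule.finrank_mono hLB
  rw [hL.1.1] at hLB'
  obtain ⟨A', hA', hA'A, hlow, hup, hpred⟩ := exists_lowered_flag hA k (by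
      have := k.2
      omega) (fun i hi => by
      have h1 := hk' i hi
      rw [Fin.le_def] at hi
      have := i.2
      omega) (fun i hi => by
      have h1 := hle i
      have h2 := hmin i |>.mt (not_not.2 hi)
      rw [Fin.lt_def] at hi
      have := k.2
      omega)
  have hlast : A' (Fin.last (r + 1)) = A (Fin.last r).castSucc := hpred _ _ hklast (by simp)
  have hA'B : ∀ i, A' i ≤ A (Fin.last r).castSucc := fun i => by
    rw [← hlast]; exact hA'.monotone (Fin.le_last i)
  refine ⟨A', r + 1 + 1 - k, hA', hlast, ⟨L, ⟨hL.1.1, fun i => ?_⟩, hL.2⟩, fun L' hL' => ?_,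
    delta_le_delta_add k hlow hup, finrank_lastKernel_add_le hA hφ hB hx hxB k hk'⟩
  -- From `k` on, the conditions for the lowered flag hold for any subspace of `B` of the right
  -- dimension.
  · by_cases hi : k ≤ i
    · have h1 := finrank_add_le_finrank_inf_add hLB (hA'B i)
      rw [hL.1.1] at h1
      have h2 := hup i hi
      have h3 := hk' i hi
      have := i.2
      omega
    · rw [hlow i (not_le.1 hi)]
      exact hL.1.2 i
  · refine ⟨⟨⟨hL'.1.1, fun i => (hL'.1.2 i).trans
      (Submodule.finrank_mono (inf_le_inf_left _ (hA'A i)))⟩, hL'.2⟩, ?_⟩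
    rw [← hlast]
    exact le_last_of_mem_schubertVariety hL'.1

end HyperplaneCase

/-! ### The lower bound `q^δ` for every nonempty support. -/

section LowerBound

variable {F V : Type*} [Field F] [AddCommGroup V] [Module F V] [FiniteDimensional F V]

theorem pow_delta_le_of_hyperplane [Finite F] {r : ℕ} {A : Fin (r + 1 + 1) → Submodule F V}
    (hA : StrictMono A) {φ : V [⋀^Fin (r + 1 + 1)]→ₗ[F] F} (hφ : (support A φ).Nonempty)
    (ih : ∀ ψ : V [⋀^Fin (r + 1)]→ₗ[F] F,
      (support (fun i : Fin (r + 1) => A i.castSucc) ψ).Nonempty →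
      Nat.card F ^ delta (fun i : Fin (r + 1) => A i.castSucc) ≤
        (support (fun i : Fin (r + 1) => A i.castSucc) ψ).ncard)
    (ihA : ∀ A' : Fin (r + 1 + 1) → Submodule F V, StrictMono A' →
      finrank F (A' (Fin.last (r + 1))) < finrank F (A (Fin.last (r + 1))) →
      (support A' φ).Nonempty → Nat.card F ^ delta A' ≤ (support A' φ).ncard)
    (hB : finrank F (A (Fin.last r).castSucc) + 1 = finrank F (A (Fin.last (r + 1))))
    (hK : ¬ lastKernel A φ ≤ A (Fin.last r).castSucc) :
    Nat.card F ^ delta A ≤ (support A φ).ncard := by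
  have : Finite V := Module.finite_of_finite F
  obtain ⟨x, hx, hxB⟩ := SetLike.not_le_iff_exists.1 hK
  have hBT : A (Fin.last r).castSucc ≤ A (Fin.last (r + 1)) := hA.monotone (Fin.le_last _)
  have hKT := lastKernel_le A φ
  have hsup : A (Fin.last r).castSucc ⊔ lastKernel A φ = A (Fin.last (r + 1)) := by
    refine Submodule.eq_of_le_of_finrank_le (sup_le hBT hKT) ?_
    have h1 : A (Fin.last r).castSucc < A (Fin.last r).castSucc ⊔ lastKernel A φ :=
      lt_of_le_of_ne le_sup_left fun he => hxB (by
        rw [he]; exact Submodule.mem_sup_right hx)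
    have := Submodule.finrank_lt_finrank_of_lt h1
    omega
  have hLle : ∀ L' ∈ schubertVariety (fun i : Fin (r + 1) => A i.castSucc),
      L' ≤ A (Fin.last r).castSucc := fun L' hL' => le_last_of_mem_schubertVariety hL'
  have key := card_sdiff_mul_le hA.monotone φ hBT hLle _ ih
  obtain ⟨A', s, hA', hlast, hne, hsub, hdelta, hcodim⟩ :=
    exists_lowered_support hA hφ hB hx hxB hsup
  have hlow := ihA A' hA' (by rw [hlast]; omega) hne
  have hS2 := hlow.trans (Set.ncard_le_ncard hsub (Set.toFinite _))
  have hsplit : {L ∈ support A φ | ¬ L ≤ A (Fin.last r).castSucc}.ncard +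
      {L ∈ support A φ | L ≤ A (Fin.last r).castSucc}.ncard = (support A φ).ncard := by
    rw [add_comm]
    exact Set.ncard_inter_add_ncard_sdiff_eq_ncard (support A φ)
      {L | L ≤ A (Fin.last r).castSucc} (Set.toFinite _)
  have hunion := Set.ncard_union_add_ncard_inter
    (A (Fin.last r).castSucc : Set V) (lastKernel A φ : Set V)
  rw [← Submodule.coe_inf, ncard_coe_submodule, ncard_coe_submodule, ncard_coe_submodule]
    at hunion
  have hdim := Submodule.finrank_sup_add_finrank_inf_eq (A (Fin.last r).castSucc)
    (lastKernel A φ)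
  rw [hsup] at hdim
  rw [Set.ncard_sdiff (Set.union_subset hBT hKT) (Set.toFinite _), ncard_coe_submodule] at key
  obtain ⟨L, hL⟩ := hφ
  have haL := Submodule.finrank_mono (le_last_of_mem_schubertVariety hL.1)
  rw [hL.1.1] at haL
  have hds := delta_succ A
  set S1 := {L ∈ support A φ | ¬ L ≤ A (Fin.last r).castSucc}.ncard
  set S2 := {L ∈ support A φ | L ≤ A (Fin.last r).castSucc}.ncard
  set U := ((A (Fin.last r).castSucc : Set V) ∪ lastKernel A φ).ncard
  set q := Nat.card F
  have hq1 : 1 < q := one_lt_natCard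
  set D := delta (fun i : Fin (r + 1) => A i.castSucc)
  obtain ⟨a, ha⟩ : ∃ a, finrank F (A (Fin.last r).castSucc) = a := ⟨_, rfl⟩
  obtain ⟨κ, hκ⟩ : ∃ κ, finrank F ↥(A (Fin.last r).castSucc ⊓ lastKernel A φ) = κ := ⟨_, rfl⟩
  have hκ' : finrank F (lastKernel A φ) = κ + 1 := by omega
  rw [← hB, ha] at key haL hcodim hds
  rw [ha, hκ, hκ'] at hunion
  rw [hκ'] at hcodim
  have hq0 : 0 < q := by omega
  -- Inclusion-exclusion with `|B| = q^a`, `|K| = q^(κ+1)`, `|B ∩ K| = q^κ`.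
  have hU : q ^ (a + 1) - U = (q - 1) * (q ^ a - q ^ κ) := by
    have h1 : q ^ (a + 1) = q * q ^ a := pow_succ' q a
    have h2 : q ^ (κ + 1) = q * q ^ κ := pow_succ' q κ
    have h3 : q ^ κ ≤ q ^ a := Nat.pow_le_pow_right hq0 (by omega)
    obtain ⟨e, he⟩ := Nat.exists_eq_add_of_le h3
    obtain ⟨p, hp⟩ := Nat.exists_eq_add_of_le hq1.le
    rw [h2, he] at hunion
    rw [h1, he]
    have hU' : U + p * e = q * (q ^ κ + e) := by
      rw [hp] at hunion ⊢
      nlinarith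
    rw [← hU', Nat.add_sub_cancel_left, Nat.add_sub_cancel_left, hp, Nat.add_sub_cancel_left]
  have hq' : q ^ (r + 1 + 1) - q ^ (r + 1) = (q - 1) * q ^ (r + 1) := by
    rw [Nat.sub_mul, one_mul]; congr 1; ring
  rw [hU, hq'] at key
  have key' : (q ^ a - q ^ κ) * q ^ D ≤ S1 * q ^ (r + 1) := by
    refine Nat.le_of_mul_le_mul_left (c := q - 1) ?_ (by omega)
    calc _ = (q - 1) * (q ^ a - q ^ κ) * q ^ D := by ring
      _ ≤ _ := key
      _ = _ := by ring
  -- The points inside `B` supply exactly the term `q^κ` missing from `key'`; the exponents compare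
  -- by `hdelta` and `hcodim`.
  have h4 : q ^ κ * q ^ D ≤ S2 * q ^ (r + 1) := by
    calc q ^ κ * q ^ D = q ^ (κ + D) := by rw [pow_add]
      _ ≤ q ^ (delta A' + (r + 1)) := Nat.pow_le_pow_right hq0 (by omega)
      _ = q ^ delta A' * q ^ (r + 1) := by rw [pow_add]
      _ ≤ _ := Nat.mul_le_mul_right _ hS2
  rw [← hsplit]
  refine Nat.le_of_mul_le_mul_right (c := q ^ (r + 1)) ?_ (Nat.pow_pos hq0)
  calc q ^ delta A * q ^ (r + 1) = q ^ a * q ^ D := by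
        rw [← pow_add, ← pow_add]; congr 1; omega
    _ ≤ ((q ^ a - q ^ κ) + q ^ κ) * q ^ D := Nat.mul_le_mul_right _ (by omega)
    _ = (q ^ a - q ^ κ) * q ^ D + q ^ κ * q ^ D := by rw [add_mul]
    _ ≤ S1 * q ^ (r + 1) + S2 * q ^ (r + 1) := Nat.add_le_add key' h4
    _ = _ := by rw [add_mul]

/-- The minimum distance of Schubert codes: a form which does not vanish identically on the
Schubert variety is nonzero on at least `q^δ` of its points. -/
theorem pow_delta_le_ncard_support [Finite F] {ℓ : ℕ} {A : Fin ℓ → Submodule F V}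
    (hA : StrictMono A) (φ : V [⋀^Fin ℓ]→ₗ[F] F) (hφ : (support A φ).Nonempty) :
    Nat.card F ^ delta A ≤ (support A φ).ncard := by
  have : Finite V := Module.finite_of_finite F
  induction ℓ with
  | zero =>
    have h1 : delta A = 0 := by simp [delta]
    rw [h1, pow_zero]
    exact (Set.ncard_pos (Set.toFinite _)).2 hφ
  | succ ℓ ihℓ =>
    -- The hyperplane case passes to a flag of the same length with smaller last space and the same
    -- `φ`, hence this second induction.
    induction hd : finrank F (A (Fin.last ℓ)) using Nat.strong_induction_on generalizing A with
    | _ d ihd =>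
    have hA' : StrictMono (fun i : Fin ℓ => A i.castSucc) :=
      fun i j hij => hA (Fin.castSucc_lt_castSucc_iff.2 hij)
    have ih := ihℓ hA'
    have hKlt := Submodule.finrank_lt_finrank_of_lt (lastKernel_lt hφ)
    have hq0 : 0 < Nat.card F := Nat.card_pos
    have hsmall : ∀ W : Submodule F V, finrank F W < finrank F (A (Fin.last ℓ)) →
        (W : Set V).ncard ≤ Nat.card F ^ (finrank F (A (Fin.last ℓ)) - 1) := fun W hW => by
      rw [ncard_coe_submodule]
      exact Nat.pow_le_pow_right hq0 (by omega)
    cases ℓ with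
    | zero =>
      refine pow_delta_le_of_union_le hA.monotone hφ bot_le (fun L' hL' => ?_) ih ?_
      · exact (Submodule.finrank_eq_zero.1 hL'.1).le
      · rw [Set.union_eq_right.2 (show ((⊥ : Submodule F V) : Set V) ⊆ lastKernel A φ from
          SetLike.coe_subset_coe.2 bot_le)]
        exact hsmall _ hKlt
    | succ r =>
      have hBlt : A (Fin.last r).castSucc < A (Fin.last (r + 1)) := hA (Fin.castSucc_lt_last _)
      have hBlt' := Submodule.finrank_lt_finrank_of_lt hBlt
      have hLle : ∀ L' ∈ schubertVariety (fun i : Fin (r + 1) => A i.castSucc),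
          L' ≤ A (Fin.last r).castSucc := fun L' hL' => le_last_of_mem_schubertVariety hL'
      by_cases h1 : A (Fin.last r).castSucc ≤ lastKernel A φ
      · refine pow_delta_le_of_union_le hA.monotone hφ hBlt.le hLle ih ?_
        rw [Set.union_eq_right.2 h1]
        exact hsmall _ hKlt
      by_cases h2 : lastKernel A φ ≤ A (Fin.last r).castSucc
      · refine pow_delta_le_of_union_le hA.monotone hφ hBlt.le hLle ih ?_
        rw [Set.union_eq_left.2 h2]
        exact hsmall _ hBlt'
      by_cases h3 : finrank F (A (Fin.last r).castSucc) + 1 = finrank F (A (Fin.last (r + 1)))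
      · refine pow_delta_le_of_hyperplane hA hφ ih (fun A'' hA'' hlt hne => ?_) h3 h2
        exact ihd _ (by omega) hA'' hne rfl
      · refine pow_delta_le_of_union_le hA.monotone hφ hBlt.le hLle ih ?_
        -- Both subspaces now have codimension at least two, and `2 q^e ≤ q^(e+1)`.
        have h4 := finrank_lastKernel_add_two_le hA.monotone h1
        refine (Set.ncard_union_le _ _).trans ?_
        rw [ncard_coe_submodule, ncard_coe_submodule]
        obtain ⟨e, he⟩ : ∃ e, finrank F (A (Fin.last (r + 1))) = e + 2 :=
          ⟨finrank F (A (Fin.last (r + 1))) - 2, by omega⟩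
        rw [he] at h4 hBlt' h3 ⊢
        have hq1 : 1 < Nat.card F := one_lt_natCard
        have h5 : Nat.card F ^ finrank F (A (Fin.last r).castSucc) ≤ Nat.card F ^ e :=
          Nat.pow_le_pow_right hq0 (by omega)
        have h6 : Nat.card F ^ finrank F (lastKernel A φ) ≤ Nat.card F ^ e :=
          Nat.pow_le_pow_right hq0 (by omega)
        have h7 : Nat.card F ^ (e + 2 - 1) = Nat.card F ^ e * Nat.card F := pow_succ _ _
        rw [h7]
        have h8 : Nat.card F ^ e * 2 ≤ Nat.card F ^ e * Nat.card F := Nat.mul_le_mul_left _ hq1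
        omega

end LowerBound

/-! ### Counting the points complementary to a subspace in special position. -/

section Complements

variable {F V : Type*} [Field F] [AddCommGroup V] [Module F V] [FiniteDimensional F V]

theorem finrank_map_mkQ_add (W B : Submodule F V) :
    finrank F (B.map W.mkQ) + finrank F ↥(B ⊓ W) = finrank F B := by
  have h := LinearMap.finrank_range_add_finrank_ker (W.mkQ.domRestrict B)
  rwa [LinearMap.range_domRestrict, LinearMap.ker_domRestrict, Submodule.ker_mkQ,
    ← Submodule.finrank_map_subtype_eq, Submodule.map_comap_subtype] at h

/-- Every position lies in a block: there is a first block end at or after it, and the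
dimensions are consecutive up to there. -/
theorem exists_blockEnd {ℓ : ℕ} {A : Fin ℓ → Submodule F V} (hA : StrictMono A) (i : Fin ℓ) :
    ∃ p : Fin ℓ, i ≤ p ∧ IsBlockEnd A p ∧ finrank F (A p) = finrank F (A i) + (p - i : ℕ) ∧
      ∀ e, i ≤ e → IsBlockEnd A e → p ≤ e := by
  obtain ⟨d, hd⟩ : ∃ d, d + (i : ℕ) = ℓ := ⟨ℓ - i, by omega⟩
  induction d generalizing i with
  | zero => exact absurd i.2 (by omega)
  | succ d ih =>
    by_cases hi : IsBlockEnd A i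
    · exact ⟨i, le_rfl, hi, by simp, fun e he _ => he⟩
    · have hi' := hi
      unfold IsBlockEnd at hi
      push Not at hi
      obtain ⟨h, hlt⟩ := hi
      obtain ⟨p, h1, h2, h3, h4⟩ := ih ⟨i + 1, h⟩ (by simp only; omega)
      have h5 : A i < A ⟨i + 1, h⟩ := hA (by simp [Fin.lt_def])
      have h6 := Submodule.finrank_lt_finrank_of_lt h5
      rw [Fin.le_def] at h1
      simp only at h1 h3
      refine ⟨p, by rw [Fin.le_def]; omega, h2, by omega, fun e he hbe => h4 e ?_ hbe⟩
      have hne : i ≠ e := fun h => hi' (h ▸ hbe)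
      have : i < e := lt_of_le_of_ne he hne
      rw [Fin.lt_def] at this
      rw [Fin.le_def]
      exact this

/-- The number of points of the Schubert variety which are complementary to a subspace `W` in
special position with respect to the flag. -/
theorem ncard_complements [Finite F] {ℓ : ℕ} {A : Fin ℓ → Submodule F V} (hA : StrictMono A)
    (W : Submodule F V)
    (hW : ∀ i, IsBlockEnd A i → finrank F ↥(W ⊓ A i) + ((i : ℕ) + 1) = finrank F (A i)) :
    {L ∈ schubertVariety A | L ⊓ W = ⊥}.ncard = Nat.card F ^ delta A := by
  choose p hip hpend hpdim hpmin using exists_blockEnd hA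
  let B : Fin ℓ → Submodule F V := fun i => A (p i)
  have hdim : ∀ i : Fin ℓ, finrank F ↥(W ⊓ B i) + ((p i : ℕ) + 1) = finrank F (B i) :=
    fun i => hW _ (hpend i)
  have hpp : ∀ i j, j ≤ p i → p j ≤ p i := fun i j hj => hpmin j _ hj (hpend i)
  have hmap : ∀ i : Fin ℓ, finrank F ((B i).map W.mkQ) = (p i : ℕ) + 1 := fun i => by
    have h1 := finrank_map_mkQ_add W (B i)
    rw [inf_comm] at h1
    have h2 := hdim i
    omega
  obtain ⟨u, hu, huB⟩ := exists_linearIndependent_mem (fun i => (B i).map W.mkQ) fun i => by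
    have := hip i
    rw [Fin.le_def] at this
    rw [hmap]
    omega
  choose e heB heu using huB
  -- The lifts `e i` of `u i` are fixed; every other lift inside `B i` differs by an element of `W ⊓
  -- B i`. Since a complement meets `W` trivially, it contains at most one lift of each `u i`, so
  -- `Φ` is injective.
  let Φ : (∀ i, ↥(W ⊓ B i)) → Submodule F V := fun w =>
    Submodule.span F (Set.range fun i => e i + w i)
  have hmk : ∀ (w : ∀ i, ↥(W ⊓ B i)) i, W.mkQ (e i + w i) = u i := fun w i => by
    rw [map_add, heu]
    have : W.mkQ (w i : V) = 0 := by
      rw [Submodule.mkQ_apply, Submodule.Quotient.mk_eq_zero]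
      exact (w i).2.1
    rw [this, add_zero]
  have hliQ : ∀ w : ∀ i, ↥(W ⊓ B i), LinearIndependent F (fun i => W.mkQ (e i + w i)) :=
    fun w => by simpa only [hmk] using hu
  have hli : ∀ w : ∀ i, ↥(W ⊓ B i), LinearIndependent F (fun i => e i + (w i : V)) :=
    fun w => LinearIndependent.of_comp W.mkQ (hliQ w)
  have hdisj : ∀ (w : ∀ i, ↥(W ⊓ B i)) (x : V), x ∈ Φ w → x ∈ W → x = 0 := fun w x hx hxW =>
    eq_zero_of_mem_span_of_map_eq_zero (hliQ w) hx
      ((Submodule.Quotient.mk_eq_zero W).2 hxW)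
  have hinj : Function.Injective Φ := by
    intro w w' h
    funext i
    have h1 : e i + (w i : V) ∈ Φ w := Submodule.subset_span ⟨i, rfl⟩
    have h2 : e i + (w' i : V) ∈ Φ w := by rw [h]; exact Submodule.subset_span ⟨i, rfl⟩
    have h3 := hdisj w _ (sub_mem h1 h2) (by
      rw [add_sub_add_left_eq_sub]; exact sub_mem (w i).2.1 (w' i).2.1)
    rw [add_sub_add_left_eq_sub, sub_eq_zero] at h3
    exact Subtype.ext h3
  have hrange : {L ∈ schubertVariety A | L ⊓ W = ⊥} = Set.range Φ := by
    ext L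
    constructor
    · rintro ⟨hL, hLW⟩
      have hmem : ∀ i, ∃ l ∈ L ⊓ B i, W.mkQ l = u i := by
        intro i
        have h1 := finrank_map_mkQ_add W (L ⊓ B i)
        have h2 : L ⊓ B i ⊓ W = ⊥ := le_bot_iff.1
          ((inf_le_inf_right W inf_le_left).trans hLW.le)
        rw [h2, finrank_bot, add_zero] at h1
        have h3 := hL.2 (p i)
        -- The incidence condition at the block end leaves no room: `L ⊓ B i` embeds modulo `W` and
        -- already has the dimension of the image of `B i`.
        have h4 : (L ⊓ B i).map W.mkQ = (B i).map W.mkQ :=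
          Submodule.eq_of_le_of_finrank_le (Submodule.map_mono inf_le_right)
            (by rw [hmap, h1]; exact h3)
        have h5 : u i ∈ (B i).map W.mkQ := ⟨e i, heB i, heu i⟩
        rw [← h4] at h5
        exact h5
      choose l hl hlu using hmem
      have hw : ∀ i, l i - e i ∈ W ⊓ B i := fun i => by
        refine ⟨?_, sub_mem (hl i).2 (heB i)⟩
        have : W.mkQ (l i - e i) = 0 := by rw [map_sub, hlu, heu, sub_self]
        exact (Submodule.Quotient.mk_eq_zero W).1 this
      refine ⟨fun i => ⟨l i - e i, hw i⟩, ?_⟩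
      exact span_range_eq_of_finrank (hli _) (fun i => by simpa using (hl i).1) hL.1
    · rintro ⟨w, rfl⟩
      have hfin : finrank F (Φ w) = ℓ := by
        rw [finrank_span_eq_card (hli w), Fintype.card_fin]
      refine ⟨⟨hfin, fun i => ?_⟩, ?_⟩
      -- The condition is met at the block end `p i`; passing down to `A i` costs at most `p i - i`
      -- dimensions, as dimensions within a block are consecutive.
      · have h1 := le_finrank_span_inf (hli w) (A (p i)) (p i) fun j hj =>
          hA.monotone (hpp i j hj) (add_mem (heB j) (w j).2.2)
        have h2 := finrank_add_le_finrank_inf_add (L := Φ w ⊓ A (p i)) (W := A i)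
          inf_le_right (hA.monotone (hip i))
        rw [inf_assoc, inf_eq_right.2 (hA.monotone (hip i))] at h2
        have h3 := hpdim i
        have h4 := hip i
        rw [Fin.le_def] at h4
        change (p i : ℕ) + 1 ≤ finrank F ↥(Φ w ⊓ A (p i)) at h1
        omega
      · rw [eq_bot_iff]
        intro x hx
        exact (Submodule.mem_bot F).2 (hdisj w x hx.1 hx.2)
  rw [hrange, Set.ncard_range_of_injective hinj, Nat.card_pi, delta, ← Finset.prod_pow_eq_pow_sum]
  refine Finset.prod_congr rfl fun i _ => ?_
  rw [natCard_submodule]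
  congr 1
  have h1 := hdim i
  have h2 := hpdim i
  have h3 := hip i
  rw [Fin.le_def] at h3
  change finrank F ↥(W ⊓ B i) + ((p i : ℕ) + 1) = finrank F (A (p i)) at h1
  omega

end Complements

/-! ### Alternating forms attached to elements of the exterior power. -/

section Forms

variable {F V : Type*} [Field F] [AddCommGroup V] [Module F V]

/-- The alternating form `(v₁, …, v_c) ↦ f ∧ v₁ ∧ ⋯ ∧ v_c` attached to `f ∈ ⋀^a V`. -/
noncomputable def wedgeForm {a c m : ℕ} (h : a + c = m) (b : Basis (Fin m) F V) (f : ⋀[F]^a V) :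
    V [⋀^Fin c]→ₗ[F] F :=
  (topCoord b ∘ₗ
    { toFun := fun g => wedge h f g
      map_add' := fun _ _ => Subtype.ext (mul_add _ _ _)
      map_smul' := fun _ _ => Subtype.ext (mul_smul_comm _ _ _) :
        ⋀[F]^c V →ₗ[F] ⋀[F]^m V }).compAlternatingMap (exteriorPower.ιMulti F c)

theorem wedgeForm_apply {a c m : ℕ} (h : a + c = m) (b : Basis (Fin m) F V) (f : ⋀[F]^a V)
    (v : Fin c → V) :
    wedgeForm h b f v = topCoord b (wedge h f (exteriorPower.ιMulti F c v)) := rfl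

theorem wedgeForm_ιMulti {a c m : ℕ} (h : a + c = m) (b : Basis (Fin m) F V) (g : Fin a → V)
    (v : Fin c → V) :
    wedgeForm h b (exteriorPower.ιMulti F a g) v =
      b.det (fun i => Fin.append g v (Fin.cast h.symm i)) := by
  subst h
  rw [wedgeForm_apply]
  have : wedge rfl (exteriorPower.ιMulti F a g) (exteriorPower.ιMulti F c v) =
      exteriorPower.ιMulti F (a + c) (Fin.append g v) :=
    Subtype.ext (ExteriorAlgebra.ιMulti_mul_ιMulti g v)
  rw [this]
  exact exteriorPower.alternatingMapLinearEquiv_apply_ιMulti _ _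

theorem mem_annihilator {d : ℕ} {f : ⋀[F]^d V} {x : V} :
    x ∈ annihilator f ↔ (f : ExteriorAlgebra F V) * ExteriorAlgebra.ι F x = 0 := Iff.rfl

theorem mem_annihilator_ιMulti {d : ℕ} (v : Fin d → V) (i : Fin d) :
    v i ∈ annihilator (exteriorPower.ιMulti F d v) := by
  have h1 : ExteriorAlgebra.ι F (v i) = ExteriorAlgebra.ιMulti F 1 (fun _ => v i) := by
    simp [ExteriorAlgebra.ιMulti_apply]
  rw [mem_annihilator, exteriorPower.ιMulti_apply_coe, h1, ExteriorAlgebra.ιMulti_mul_ιMulti]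
  refine AlternatingMap.map_eq_zero_of_eq _ _ (i := Fin.castAdd 1 i) (j := Fin.natAdd d 0) ?_ ?_
  · simp
  · intro h
    have := congrArg Fin.val h
    simp at this
    omega

theorem wedgeForm_eq_zero_of_mem_annihilator {a c m : ℕ} (h : a + c = m) (b : Basis (Fin m) F V)
    {f : ⋀[F]^a V} {v : Fin c → V} (j : Fin c) (hj : v j ∈ annihilator f) :
    wedgeForm h b f v = 0 := by
  cases c with
  | zero => exact j.elim0
  | succ c =>
    have h1 : wedgeForm h b f (v ∘ Equiv.swap 0 j) = 0 := by
      rw [wedgeForm_apply]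
      have : wedge h f (exteriorPower.ιMulti F (c + 1) (v ∘ Equiv.swap 0 j)) = 0 := by
        refine Subtype.ext ?_
        change (f : ExteriorAlgebra F V) * ExteriorAlgebra.ιMulti F (c + 1) _ = 0
        rw [ExteriorAlgebra.ιMulti_succ_apply, ← mul_assoc, Function.comp_apply,
          Equiv.swap_apply_left, mem_annihilator.1 hj, zero_mul]
      rw [this, map_zero]
    rw [AlternatingMap.map_perm] at h1
    rcases Int.units_eq_one_or (Equiv.Perm.sign (Equiv.swap 0 j)) with hs | hs
    · simpa [hs] using h1
    · simpa [hs] using h1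

/-- A vector `∑ k_i u_i` of `L` annihilating `f`, substituted for `u_j`, multiplies the value by
`k_j` and yet gives zero. Conversely, the factors of `f` lie in its annihilator, so together with a
basis of `L` they form a basis of `V`, of nonzero determinant. -/
theorem nonzeroOn_wedgeForm_iff [FiniteDimensional F V] {a c m : ℕ} (h : a + c = m)
    (b : Basis (Fin m) F V) {f : ⋀[F]^a V} (hf : Decomposable f) {L : Submodule F V}
    (hL : finrank F L = c) :
    NonzeroOn (wedgeForm h b f) L ↔ L ⊓ annihilator f = ⊥ := by
  constructor
  · rintro ⟨u, huL, hu0⟩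
    rw [eq_bot_iff]
    rintro x ⟨hxL, hxf⟩
    rw [← span_range_eq_of_finrank (linearIndependent_of_apply_ne_zero hu0) huL hL] at hxL
    obtain ⟨k, rfl⟩ := (Submodule.mem_span_range_iff_exists_fun F).1 hxL
    have hk : ∀ j, k j = 0 := by
      intro j
      have h1 := wedgeForm_eq_zero_of_mem_annihilator h b (f := f)
        (v := Function.update u j (∑ i, k i • u i)) j (by rwa [Function.update_self])
      rw [AlternatingMap.map_update_sum, Finset.sum_eq_single j] at h1
      · rw [AlternatingMap.map_update_smul, Function.update_eq_self, smul_eq_mul] at h1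
        exact (mul_eq_zero.1 h1).resolve_right hu0
      · intro i _ hij
        rw [AlternatingMap.map_update_smul, AlternatingMap.map_update_self _ _ hij.symm, smul_zero]
      · intro hj; exact absurd (Finset.mem_univ _) hj
    rw [Submodule.mem_bot]
    simp [hk]
  · intro hdisj
    obtain ⟨hf0, g, rfl⟩ := hf
    have hg : LinearIndependent F g :=
      not_imp_comm.1 ((exteriorPower.ιMulti F a).map_linearDependent g) hf0
    obtain ⟨u, hu, huL⟩ := exists_linearIndependent_mem (fun _ : Fin c => L) fun i => by
      rw [hL]; exact i.2
    refine ⟨u, huL, ?_⟩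
    have hgs : Submodule.span F (Set.range g) ≤ annihilator (exteriorPower.ιMulti F a g) := by
      refine Submodule.span_le.2 ?_
      rintro _ ⟨i, rfl⟩
      exact mem_annihilator_ιMulti g i
    have hsum := hg.sum_type hu (by
      rw [span_range_eq_of_finrank hu huL hL, disjoint_iff, eq_bot_iff, inf_comm, ← hdisj]
      exact inf_le_inf_left _ hgs)
    have hli : LinearIndependent F (fun i : Fin m => Fin.append g u (Fin.cast h.symm i)) := by
      have h1 : Fin.append g u = Sum.elim g u ∘ finSumFinEquiv.symm := by
        rw [← Fin.append_comp_sumElim]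
        funext i
        induction i using Fin.addCases <;> simp
      rw [h1]
      exact hsum.comp _ (finSumFinEquiv.symm.injective.comp (Fin.cast_injective _))
    rw [wedgeForm_ιMulti]
    refine IsUnit.ne_zero ((Basis.is_basis_iff_det b).1 ⟨hli, ?_⟩)
    refine hli.span_eq_top_of_card_eq_finrank' ?_
    rw [finrank_eq_card_basis b]

/-- The strict inequality `ℓ < dim V` rules out `P = 0`, whose annihilator would be all of `V`. -/
theorem IsRepresentative.exists_eq_ιMulti [FiniteDimensional F V] {ℓ : ℕ}
    {A : Fin ℓ → Submodule F V} {L : Submodule F V} {P : ⋀[F]^ℓ V} (hP : IsRepresentative A L P)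
    (hL : finrank F L = ℓ) (hℓ : ℓ < finrank F V) :
    ∃ u : Fin ℓ → V, P = exteriorPower.ιMulti F ℓ u ∧ LinearIndependent F u ∧ (∀ i, u i ∈ L) ∧
      Submodule.span F (Set.range u) = L := by
  obtain ⟨v, -, rfl, rfl⟩ := hP
  have hP0 : exteriorPower.ιMulti F ℓ (fun i => v i.rev) ≠ 0 := by
    intro h0
    have : annihilator (exteriorPower.ιMulti F ℓ (fun i => v i.rev)) = ⊤ := by
      rw [eq_top_iff]
      intro x _
      rw [mem_annihilator, h0]
      exact zero_mul _
    rw [this, finrank_top] at hL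
    omega
  have hu : LinearIndependent F (fun i => v (Fin.rev i)) :=
    not_imp_comm.1 ((exteriorPower.ιMulti F ℓ).map_linearDependent _) hP0
  have hmem := mem_annihilator_ιMulti (F := F) (fun i => v (Fin.rev i))
  exact ⟨_, rfl, hu, hmem, span_range_eq_of_finrank hu hmem hL⟩

end Forms

/-! ### Translation between Hamming weights and supports. -/

section Code

variable {F V : Type*} [Field F] [AddCommGroup V] [Module F V]

theorem evalMap_apply_ne_zero_iff {ℓ m n : ℕ} (hℓm : ℓ < m) (b : Basis (Fin m) F V)
    {A : Fin ℓ → Submodule F V} (L : Fin n ≃ schubertVariety A) {P : Fin n → ⋀[F]^ℓ V}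
    (hP : ∀ j, IsRepresentative A (L j : Submodule F V) (P j)) (f : ⋀[F]^(m - ℓ) V) (j : Fin n) :
    evalMap hℓm b P f j ≠ 0 ↔
      NonzeroOn (wedgeForm (Nat.sub_add_cancel hℓm.le) b f) (L j) := by
  have : FiniteDimensional F V := b.finiteDimensional_of_finite
  obtain ⟨u, hPu, hu, huL, hs⟩ := (hP j).exists_eq_ιMulti (L j).2.1
    (by rw [finrank_eq_card_basis b, Fintype.card_fin]; exact hℓm)
  have h1 : evalMap hℓm b P f j = wedgeForm (Nat.sub_add_cancel hℓm.le) b f u := by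
    rw [wedgeForm_apply, ← hPu]
    rfl
  rw [h1]
  exact ⟨fun h => ⟨u, huL, h⟩, fun h => h.apply_ne_zero hu hs⟩

theorem hammingNorm_evalMap [DecidableEq F] {ℓ m n : ℕ} (hℓm : ℓ < m) (b : Basis (Fin m) F V)
    {A : Fin ℓ → Submodule F V} (L : Fin n ≃ schubertVariety A) {P : Fin n → ⋀[F]^ℓ V}
    (hP : ∀ j, IsRepresentative A (L j : Submodule F V) (P j)) (f : ⋀[F]^(m - ℓ) V) :
    hammingNorm (evalMap hℓm b P f) =
      (support A (wedgeForm (Nat.sub_add_cancel hℓm.le) b f)).ncard := by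
  have h1 : support A (wedgeForm (Nat.sub_add_cancel hℓm.le) b f) =
      (fun j => (L j : Submodule F V)) '' {j | evalMap hℓm b P f j ≠ 0} := by
    ext M
    constructor
    · rintro ⟨hM, hnz⟩
      refine ⟨L.symm ⟨M, hM⟩, ?_, by simp⟩
      change evalMap hℓm b P f (L.symm ⟨M, hM⟩) ≠ 0
      rw [evalMap_apply_ne_zero_iff hℓm b L hP]
      simpa using hnz
    · rintro ⟨j, hj, rfl⟩
      exact ⟨(L j).2, (evalMap_apply_ne_zero_iff hℓm b L hP f j).1 hj⟩
  have h2 : Function.Injective fun j => (L j : Submodule F V) :=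
    Subtype.val_injective.comp L.injective
  rw [h1, Set.ncard_image_of_injective _ h2, Set.ncard_eq_toFinset_card', hammingNorm]
  congr 1
  ext j
  simp

end Code

end SchubertCode

theorem theorem5p3 {F V : Type*} [Field F] [Fintype F] [DecidableEq F]
    [AddCommGroup V] [Module F V] {ℓ m n : ℕ} (hℓ : 1 ≤ ℓ) (hℓm : ℓ < m)
    (b : Module.Basis (Fin m) F V)
    (A : Fin ℓ → Submodule F V) (hA : StrictMono A) (hA0 : ∀ i, A i ≠ ⊥)
    (L : Fin n ≃ SchubertCode.schubertVariety A)
    (P : Fin n → ⋀[F]^ℓ V)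
    (hP : ∀ j, SchubertCode.IsRepresentative A (L j : Submodule F V) (P j))
    (f : ⋀[F]^(m - ℓ) V) (hf : SchubertCode.SchubertDecomposable A f) :
    SchubertCode.IsMinWeightCodeword (SchubertCode.schubertCode hℓm b P)
        (SchubertCode.evalMap hℓm b P f) ∧
      hammingNorm (SchubertCode.evalMap hℓm b P f) =
        Fintype.card F ^ SchubertCode.delta A := by
  have : FiniteDimensional F V := b.finiteDimensional_of_finite
  have hwt : hammingNorm (SchubertCode.evalMap hℓm b P f) =
      Fintype.card F ^ SchubertCode.delta A := by
    rw [SchubertCode.hammingNorm_evalMap hℓm b L hP, ← Nat.card_eq_fintype_card,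
      ← SchubertCode.ncard_complements hA _ hf.2]
    congr 1
    ext M
    exact and_congr_right fun hM => SchubertCode.nonzeroOn_wedgeForm_iff _ b hf.1 hM.1
  refine ⟨⟨⟨f, rfl⟩, ⟨_, ⟨f, rfl⟩, fun h0 => ?_, rfl⟩, ?_⟩, hwt⟩
  · rw [h0, hammingNorm_zero] at hwt
    exact (Nat.pow_pos Fintype.card_pos).ne hwt
  · rintro w ⟨_, ⟨f', rfl⟩, hne, rfl⟩
    rw [hwt, SchubertCode.hammingNorm_evalMap hℓm b L hP, ← Nat.card_eq_fintype_card]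
    refine SchubertCode.pow_delta_le_ncard_support hA _ ?_
    obtain ⟨j, hj⟩ := Function.ne_iff.1 hne
    exact ⟨L j, (L j).2, (SchubertCode.evalMap_apply_ne_zero_iff hℓm b L hP f' j).1 hj⟩
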